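/- For complex numbers $x,p$ with $|p|<1$, $x\neq 0$, let $\theta(x;p)=\prod_{i\ge 0}(1-xp^i)(1-p^{i+1}/x)$, and for complex $q\ne0$ and an integer $k\ge 0$ let $(x;q,p)_k=\prod_{i=0}^{k-1}\theta(xq^i;p)$; write $\theta(x)=\theta(x;p)$ and $(x_1,\dots,x_r;q,p)_k=(x_1;q,p)_k\cdots(x_r;q,p)_k$. Let $n$ be a non-negative integer, let $p$ be a complex number with $|p|<1$, and let $a,b,q$ be non-zero complex numbers such that none of the denominators in the following identity vanishes. Then $$ \sum_{j=0}^{n} \frac{\theta(abq^{4j+1};p^2)\,(b^2q^{2n},q^{-2n},aq/b,abq;q^2,p^2)_j\,(-aq,bq;q,p)_{2j}} {\theta(abq;p^2)\,(aq^{3-2n}/b,abq^{3+2n},b^2q^2,q^2;q^2,p^2)_j\,(-bq,aq;q,p)_{2j}}\,q^{2j} $$ $$ =\frac{\theta(-b)\,(-q,b/a;q,p)_n\,(abq^3;q^2,p^2)_n} {\theta(-bq^{2n})\,(-b,aq;q,p)_n\,(b/(aq);q^2,p^2)_n}\,q^{-n} \sum_{k=0}^{n} \frac{\theta(-aq^{2k})\,(-a,bq^n,q^{-n},a/b;q,p)_k}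 {\theta(-a)\,(q,aq^{1-n}/b,aq^{1+n},-bq;q,p)_k}\,q^{k}. $$ -/

import Mathlib

noncomputable section

/-- The infinite `q`-shifted factorial `(a; q)_∞ = ∏_{j ≥ 0} (1 - a q^j)`
(the product converges for `|q| < 1`). -/
def qFacInf (a q : ℂ) : ℂ := ∏' j : ℕ, (1 - a * q ^ j)

/-- The modified Jacobi theta function `θ(a; p) = (a; p)_∞ (p/a; p)_∞`,
for `a ≠ 0` and `|p| < 1`. For `p = 0` it is `1 - a`. -/
def ellTheta (a p : ℂ) : ℂ := qFacInf a p * qFacInf (p / a) p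

/-- The theta shifted factorial `(a; q, p)_k = ∏_{j=0}^{k-1} θ(a q^j; p)`. -/
def ellFac (a q p : ℂ) (k : ℕ) : ℂ := ∏ j ∈ Finset.range k, ellTheta (a * q ^ j) p

/-- The infinite product defining `(a; q)_∞` converges for `|q| < 1`. -/
theorem multipliable_qFacInf (a : ℂ) {q : ℂ} (hq : ‖q‖ < 1) :
    Multipliable (fun j : ℕ => 1 - a * q ^ j) := by
  have h : Summable (fun j : ℕ => ‖-(a * q ^ j)‖) := by
    simpa [norm_mul, norm_pow] using
      (summable_geometric_of_lt_one (norm_nonneg q) hq).mul_left ‖a‖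
  simpa [sub_eq_add_neg] using multipliable_one_add_of_summable h

/-- At nome `0` the theta function is `1 - a`. -/
theorem ellTheta_zero (a : ℂ) : ellTheta a 0 = 1 - a := by
  have h : ∏' j : ℕ, (1 - a * (0 : ℂ) ^ j) = 1 - a := by
    rw [tprod_eq_mulSingle 0]
    · simp
    · intro j hj
      simp [hj]
  simp [ellTheta, qFacInf, h]

end

/-!
The identity is a change of Bailey pair. Write `(x)_k` for factorials in base `q` and nome `p`, and
`{x}_k` for those in base `q²` and nome `p²`. Up to powers `c^j`, `c^k` of constants and factors
free of the summation indices, the `n`-dependent part of the summand on the left is the kernel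
`{b²}_{n+j} {b/(aq)}_{n-j} / ({q²}_{n-j} {abq³}_{n+j})`, and on the right it is
`(b)_{n+k} (b/a)_{n-k} / ((q)_{n-k} (aq)_{n+k})`. Both are instances of `baileyKernel`. The
remaining parts of the summands, `leftTerm` and `rightTerm`, do not involve `n`.

Two facts give the theorem for `a, b` in general position. First, composing the kernel in base `q`
with a kernel in base `q²` is a kernel in base `q²` (`sum_baileyKernel_mul_baileyKernel`). Secondly,
`rightTerm` is, suitably normalized, the image of `leftTerm` under the second of these kernels
(`rightTerm_eq_sum`).
Substituting the second in the right-hand side and interchanging the summations yields the left-hand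
side (`sum_leftTerm_eq_sum_rightTerm`).

Both facts rest on the Frenkel–Turaev sum (`sum_vwpTerm`), which is proved by induction with the
help of the addition formula of Weierstrass (`ellTheta_add`). For the first fact, the quadratic
factor `q^k θ(-aq^{2k})` is decomposed as a combination of products of theta functions whose
arguments are linear in `q^k` (`ellTheta_duplication`). This splits the sum in question into three
Frenkel–Turaev sums, and the three values are recombined by the same theta identity. For the second
fact, a single Frenkel–Turaev sum gives the expansion of `leftTerm` in terms of `rightTerm`
(`leftTerm_eq_sum`), and the matrix in it is inverted by a telescoping sum
(`sum_baileyKernel_mul_inv`).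

The theta identities are derived from one statement, `exists_ellTheta_det`: the product
`θ(xy) θ(x/y)` is a `2 × 2` determinant in functions of `x` and of `y`, which follows from the
Jacobi triple product. It reduces every identity between products of theta functions to polynomial
algebra.

Finally, parameters in general position are dense, and both sides are continuous wherever the
denominators do not vanish, so that the genericity assumptions can be removed.
-/

open Filter Topology

/-! ### Elementary properties of the theta function -/

theorem norm_sq_lt_one {p : ℂ} (hp : ‖p‖ < 1) : ‖p ^ 2‖ < 1 := by
  rw [norm_pow]
  exact pow_lt_one₀ (norm_nonneg p) hp two_ne_zero

theorem summable_norm_mul_pow (a : ℂ) {p : ℂ} (hp : ‖p‖ < 1) :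
    Summable fun j : ℕ => ‖-(a * p ^ j)‖ := by
  simpa [norm_mul, norm_pow] using
    (summable_geometric_of_lt_one (norm_nonneg p) hp).mul_left ‖a‖

theorem qFacInf_eq_mul (a : ℂ) {p : ℂ} (hp : ‖p‖ < 1) :
    qFacInf a p = (1 - a) * qFacInf (a * p) p := by
  have h := (multipliable_qFacInf (a * p) hp)
  unfold qFacInf
  rw [tprod_eq_zero_mul' (by simpa [pow_succ', mul_assoc] using h)]
  simp [pow_succ', mul_assoc]

theorem qFacInf_eq_zero_iff (a : ℂ) {p : ℂ} (hp : ‖p‖ < 1) :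
    qFacInf a p = 0 ↔ ∃ j : ℕ, a * p ^ j = 1 := by
  constructor
  · intro h
    by_contra! hne
    refine tprod_one_add_ne_zero_of_summable (f := fun j : ℕ => -(a * p ^ j))
      (fun j hj => hne j ?_) (summable_norm_mul_pow a hp) ?_
    · linear_combination -hj
    · simpa [qFacInf, sub_eq_add_neg] using h
  · rintro ⟨j, hj⟩
    exact tprod_of_exists_eq_zero ⟨j, by rw [hj, sub_self]⟩

/-- `(x² ; p²)_∞ = (x; p)_∞ (-x; p)_∞`. -/
theorem qFacInf_sq (x : ℂ) {p : ℂ} (hp : ‖p‖ < 1) :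
    qFacInf (x ^ 2) (p ^ 2) = qFacInf x p * qFacInf (-x) p := by
  unfold qFacInf
  rw [← (multipliable_qFacInf x hp).tprod_mul (multipliable_qFacInf (-x) hp)]
  refine tprod_congr fun j => ?_
  ring

theorem continuous_qFacInf {p : ℂ} (hp : ‖p‖ < 1) : Continuous fun a => qFacInf a p := by
  have h : HasProdLocallyUniformlyOn (fun (j : ℕ) (a : ℂ) => 1 + -(a * p ^ j))
      (fun a => ∏' j : ℕ, (1 + -(a * p ^ j))) Set.univ := by
    apply hasProdLocallyUniformlyOn_of_forall_compact isOpen_univ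
    intro K _ hK
    obtain ⟨R, hR⟩ := hK.isBounded.exists_norm_le
    have hR' := (summable_geometric_of_lt_one (norm_nonneg p) hp).mul_left R
    refine hR'.hasProdUniformlyOn_nat_one_add hK (.of_forall fun j x hx => ?_)
      (fun _ => by fun_prop)
    rw [norm_neg, norm_mul, norm_pow]
    exact mul_le_mul_of_nonneg_right (hR x hx) (by positivity)
  have h2 := h.tendstoLocallyUniformlyOn_finsetRange.continuousOn
    (Filter.Frequently.of_forall fun _ => by fun_prop)
  rw [← continuousOn_univ]
  simpa [qFacInf, sub_eq_add_neg] using h2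

/-- The reflection `θ(1/x) = -θ(x)/x`. -/
theorem ellTheta_inv {x p : ℂ} (hx : x ≠ 0) (hp : ‖p‖ < 1) :
    ellTheta (1 / x) p = -(ellTheta x p) / x := by
  unfold ellTheta
  rw [qFacInf_eq_mul (1 / x) hp, qFacInf_eq_mul x hp]
  have h1 : 1 / x * p = p / x := by ring
  have h2 : p / (1 / x) = x * p := by field_simp
  rw [h1, h2]
  field_simp
  ring

/-- `θ(x²; p²) = θ(x; p) θ(-x; p)`. -/
theorem ellTheta_sq (x : ℂ) {p : ℂ} (hp : ‖p‖ < 1) :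
    ellTheta (x ^ 2) (p ^ 2) = ellTheta x p * ellTheta (-x) p := by
  unfold ellTheta
  have h : p / -x = -(p / x) := by ring
  rw [← div_pow, qFacInf_sq x hp, qFacInf_sq (p / x) hp, h]
  ring

theorem ellTheta_eq_zero_iff (x : ℂ) {p : ℂ} (hp : ‖p‖ < 1) :
    ellTheta x p = 0 ↔ (∃ j : ℕ, x * p ^ j = 1) ∨ ∃ j : ℕ, p / x * p ^ j = 1 := by
  rw [ellTheta, mul_eq_zero, qFacInf_eq_zero_iff _ hp, qFacInf_eq_zero_iff _ hp]

theorem countable_ellTheta_zeros {p : ℂ} (hp : ‖p‖ < 1) :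
    {x : ℂ | ellTheta x p = 0}.Countable := by
  refine ((Set.countable_range fun j : ℕ => (p ^ j)⁻¹).union
    (Set.countable_range fun j : ℕ => p * p ^ j)).mono fun x hx => ?_
  rcases (ellTheta_eq_zero_iff x hp).1 hx with ⟨j, hj⟩ | ⟨j, hj⟩
  · exact Or.inl ⟨j, (eq_inv_of_mul_eq_one_left hj).symm⟩
  · refine Or.inr ⟨j, ?_⟩
    have hx0 : x ≠ 0 := by
      rintro rfl
      simp at hj
    field_simp at hj
    exact hj

theorem ellTheta_neg_one_ne_zero {p : ℂ} (hp : ‖p‖ < 1) : ellTheta (-1) p ≠ 0 := by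
  have key : ∀ j : ℕ, p ^ j ≠ -1 ∨ j = 0 := by
    intro j
    rcases Nat.eq_zero_or_pos j with h | h
    · exact Or.inr h
    · left
      intro hj
      have h1 : ‖p ^ j‖ < 1 := by
        rw [norm_pow]
        exact pow_lt_one₀ (norm_nonneg _) hp h.ne'
      rw [hj] at h1
      simp at h1
  intro h
  rcases (ellTheta_eq_zero_iff _ hp).1 h with ⟨j, hj⟩ | ⟨j, hj⟩
  · rcases key j with h1 | h1
    · exact h1 (by linear_combination -hj)
    · subst h1
      norm_num at hj
  · rcases key (j + 1) with h1 | h1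
    · exact h1 (by rw [pow_succ]; linear_combination -hj)
    · omega

theorem ContinuousAt.ellTheta {X : Type*} [TopologicalSpace X] {f : X → ℂ} {x : X} {p : ℂ}
    (hp : ‖p‖ < 1) (hf : ContinuousAt f x) (h0 : f x ≠ 0) :
    ContinuousAt (fun y => ellTheta (f y) p) x := by
  unfold _root_.ellTheta
  exact ((continuous_qFacInf hp).continuousAt.comp hf).mul
    ((continuous_qFacInf hp).continuousAt.comp (continuousAt_const.div hf h0))

/-! ### Elementary properties of theta shifted factorials -/

theorem ellFac_zero (x q p : ℂ) : ellFac x q p 0 = 1 := by simp [ellFac]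

theorem ellFac_succ (x q p : ℂ) (k : ℕ) :
    ellFac x q p (k + 1) = ellFac x q p k * ellTheta (x * q ^ k) p := by
  simp [ellFac, Finset.prod_range_succ]

theorem ellFac_succ' (x q p : ℂ) (k : ℕ) :
    ellFac x q p (k + 1) = ellTheta x p * ellFac (x * q) q p k := by
  simp [ellFac, Finset.prod_range_succ', pow_succ', mul_assoc, mul_comm]

theorem ellFac_add (x q p : ℂ) (j k : ℕ) :
    ellFac x q p (j + k) = ellFac x q p j * ellFac (x * q ^ j) q p k := by
  simp [ellFac, Finset.prod_range_add, pow_add, mul_assoc]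

theorem ellFac_ne_zero {x q p : ℂ} {k : ℕ} (h : ∀ i < k, ellTheta (x * q ^ i) p ≠ 0) :
    ellFac x q p k ≠ 0 :=
  Finset.prod_ne_zero_iff.2 fun i hi => h i (Finset.mem_range.1 hi)

theorem ellFac_sq (x q : ℂ) {p : ℂ} (hp : ‖p‖ < 1) (k : ℕ) :
    ellFac (x ^ 2) (q ^ 2) (p ^ 2) k = ellFac x q p k * ellFac (-x) q p k := by
  simp only [ellFac, ← Finset.prod_mul_distrib]
  refine Finset.prod_congr rfl fun i _ => ?_
  rw [← neg_mul_eq_neg_mul x, ← ellTheta_sq _ hp]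
  ring_nf

theorem ContinuousAt.ellFac {X : Type*} [TopologicalSpace X] {f : X → ℂ} {x : X} {p q : ℂ}
    (hp : ‖p‖ < 1) (hq : q ≠ 0) (hf : ContinuousAt f x) (h0 : f x ≠ 0) (k : ℕ) :
    ContinuousAt (fun y => ellFac (f y) q p k) x := by
  unfold _root_.ellFac
  refine tendsto_finsetProd _ fun i _ => ?_
  exact ContinuousAt.ellTheta hp (hf.mul continuousAt_const) (mul_ne_zero h0 (pow_ne_zero _ hq))

/-- Reversal of the factors of two shifted factorials of equal length; the monomials that
come from `θ(1/x) = -θ(x)/x` combine to a single power. -/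
theorem ellFac_reverse_div {x y q p : ℂ} (hx : x ≠ 0) (hy : y ≠ 0) (hq : q ≠ 0) (hp : ‖p‖ < 1)
    (j : ℕ) :
    ellFac (q / (x * q ^ j)) q p j / ellFac (q / (y * q ^ j)) q p j
      = (y / x) ^ j * (ellFac x q p j / ellFac y q p j) := by
  have key : ∀ z : ℂ, z ≠ 0 → ellFac (q / (z * q ^ j)) q p j
      = ∏ i ∈ Finset.range j, (-(ellTheta (z * q ^ i) p) / (z * q ^ i)) := by
    intro z hz
    unfold ellFac
    rw [← Finset.prod_range_reflect]
    refine Finset.prod_congr rfl fun i hi => ?_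
    rw [← ellTheta_inv (mul_ne_zero hz (pow_ne_zero _ hq)) hp]
    congr 1
    have hi := Finset.mem_range.1 hi
    obtain ⟨d, rfl⟩ : ∃ d, j = i + 1 + d := ⟨j - (i + 1), by omega⟩
    have : i + 1 + d - 1 - i = d := by omega
    rw [this]
    field_simp
    ring
  rw [key x hx, key y hy, ← Finset.prod_div_distrib]
  have : (y / x) ^ j = ∏ i ∈ Finset.range j, (y / x) := by
    rw [Finset.prod_const, Finset.card_range]
  unfold ellFac
  rw [this, ← Finset.prod_div_distrib, ← Finset.prod_mul_distrib]
  refine Finset.prod_congr rfl fun i _ => ?_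
  have hqi := pow_ne_zero i hq
  by_cases h : ellTheta (y * q ^ i) p = 0
  · simp [h]
  · field_simp

/-! ### The Jacobi triple product -/

/-- The `q`-Pochhammer symbol `(p; p)_n`. -/
def pochP (p : ℂ) (n : ℕ) : ℂ := ∏ i ∈ Finset.range n, (1 - p ^ (i + 1))

theorem pochP_zero (p : ℂ) : pochP p 0 = 1 := by simp [pochP]

theorem pochP_succ (p : ℂ) (n : ℕ) : pochP p (n + 1) = pochP p n * (1 - p ^ (n + 1)) := by
  simp [pochP, Finset.prod_range_succ]

theorem one_sub_pow_ne_zero {p : ℂ} (hp : ‖p‖ < 1) (n : ℕ) : 1 - p ^ (n + 1) ≠ 0 := by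
  intro h
  have h1 : ‖p ^ (n + 1)‖ < 1 := by
    rw [norm_pow]
    exact pow_lt_one₀ (norm_nonneg _) hp (Nat.succ_ne_zero n)
  rw [← sub_eq_zero.1 h] at h1
  simp at h1

theorem pochP_ne_zero {p : ℂ} (hp : ‖p‖ < 1) (n : ℕ) : pochP p n ≠ 0 :=
  Finset.prod_ne_zero_iff.2 fun i _ => one_sub_pow_ne_zero hp i

/-- The `q`-binomial theorem, with the Gaussian binomial coefficients written as quotients
of `q`-Pochhammer symbols. -/
theorem prod_one_add_mul_pow {p : ℂ} (hp : ‖p‖ < 1) (y : ℂ) (M : ℕ) :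
    ∏ i ∈ Finset.range M, (1 + y * p ^ i)
      = ∑ j ∈ Finset.range (M + 1),
          p ^ (j.choose 2) * (pochP p M / (pochP p j * pochP p (M - j))) * y ^ j := by
  induction M with
  | zero => simp [pochP_zero]
  | succ M ih =>
    have hP := pochP_ne_zero hp
    set F : ℕ → ℂ := fun j =>
      p ^ (j.choose 2) * (pochP p M / (pochP p j * pochP p (M - j))) * y ^ j with hF
    rw [Finset.prod_range_succ, ih, mul_add, mul_one]
    nth_rewrite 1 [Finset.sum_range_succ' F M]
    rw [Finset.sum_range_succ F M, Finset.sum_range_succ' _ (M + 1), Finset.sum_range_succ _ M]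
    have hmid : ∀ j ∈ Finset.range M,
        p ^ ((j + 1).choose 2) * (pochP p (M + 1) / (pochP p (j + 1) * pochP p (M + 1 - (j + 1))))
            * y ^ (j + 1)
          = p ^ ((j + 1).choose 2) * (pochP p M / (pochP p (j + 1) * pochP p (M - (j + 1))))
              * y ^ (j + 1)
            + p ^ (j.choose 2) * (pochP p M / (pochP p j * pochP p (M - j))) * y ^ j
              * (y * p ^ M) := by
      intro j hj
      obtain ⟨d, rfl⟩ : ∃ d, M = j + 1 + d := ⟨M - (j + 1), by
        have := Finset.mem_range.1 hj
        omega⟩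
      have e1 : j + 1 + d + 1 - (j + 1) = d + 1 := by omega
      have e2 : j + 1 + d - (j + 1) = d := by omega
      have e3 : j + 1 + d - j = d + 1 := by omega
      have e4 : (j + 1).choose 2 = j + j.choose 2 := by
        rw [Nat.choose_succ_succ' j 1, Nat.choose_one_right]
      rw [e1, e2, e3, e4, pochP_succ p (j + 1 + d), pochP_succ p j, pochP_succ p d]
      have h1 := hP j
      have h2 := hP d
      have h3 := one_sub_pow_ne_zero hp j
      have h4 := one_sub_pow_ne_zero hp d
      field_simp
      ring
    rw [Finset.sum_congr rfl hmid, Finset.sum_add_distrib, ← Finset.sum_mul]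
    have e5 : M + 1 - (M + 1) = 0 := by omega
    have e6 : (M + 1).choose 2 = M + M.choose 2 := by
      rw [Nat.choose_succ_succ' M 1, Nat.choose_one_right]
    have h1 := hP M
    have h2 := hP (M + 1)
    simp only [hF, e5, e6, Nat.sub_self, Nat.sub_zero, pochP_zero, pow_zero, mul_one, one_mul,
      div_self h1, div_self h2]
    ring

theorem two_mul_choose_two (j : ℕ) : (2 : ℤ) * (j.choose 2 : ℕ) = j * j - j := by
  induction j with
  | zero => simp
  | succ j ih =>
    rw [Nat.choose_succ_succ' j 1, Nat.choose_one_right]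
    push_cast
    linarith

theorem sum_range_add_one (N : ℕ) : ∑ i ∈ Finset.range N, (i + 1) = (N + 1).choose 2 := by
  induction N with
  | zero => simp
  | succ N ih =>
    rw [Finset.sum_range_succ, ih, Nat.choose_succ_succ' (N + 1) 1, Nat.choose_one_right]
    exact Nat.add_comm _ _

theorem pow_choose_two_eq_zpow (r : ℂ) (j : ℕ) :
    (r ^ 2) ^ (j.choose 2) = r ^ ((j : ℤ) * j - j) := by
  rw [← two_mul_choose_two, ← pow_mul, ← zpow_natCast]
  congr 1

/-- Finite form of the Jacobi triple product, with nome `r ^ 2`. -/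
theorem finite_triple_product {r x : ℂ} (hr : r ≠ 0) (hp : ‖r ^ 2‖ < 1) (hx : x ≠ 0) (N : ℕ) :
    (∏ i ∈ Finset.range N, (1 - x * (r ^ 2) ^ i))
        * ∏ i ∈ Finset.range N, (1 - r ^ 2 / x * (r ^ 2) ^ i)
      = ∑ j ∈ Finset.range (2 * N + 1),
          (-x) ^ ((j : ℤ) - N) * r ^ (((j : ℤ) - N) * (j - N) - (j - N))
            * (pochP (r ^ 2) (2 * N) / (pochP (r ^ 2) j * pochP (r ^ 2) (2 * N - j))) := by
  -- The `q`-binomial theorem is applied to a product of `2N` factors. The first `N` of them,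
  -- reversed, are the factors with `1/x` up to monomials.
  have h := prod_one_add_mul_pow hp (-x / (r ^ 2) ^ N) (2 * N)
  set p := r ^ 2 with hpdef
  have hp0 : p ≠ 0 := pow_ne_zero 2 hr
  have hnx : -x ≠ 0 := neg_ne_zero.2 hx
  have h1 : ∏ i ∈ Finset.range (2 * N), (1 + -x / p ^ N * p ^ i)
      = ((-x) ^ N / p ^ ((N + 1).choose 2)) * ((∏ i ∈ Finset.range N, (1 - x * p ^ i))
        * ∏ i ∈ Finset.range N, (1 - p / x * p ^ i)) := by
    have h2 : ∏ i ∈ Finset.range N, (1 + -x / p ^ N * p ^ i)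
        = ((-x) ^ N / p ^ ((N + 1).choose 2)) * ∏ i ∈ Finset.range N, (1 - p / x * p ^ i) := by
      have h3 : (-x) ^ N / p ^ ((N + 1).choose 2) = ∏ i ∈ Finset.range N, (-x / p ^ (i + 1)) := by
        rw [Finset.prod_div_distrib, Finset.prod_const, Finset.card_range,
          Finset.prod_pow_eq_pow_sum]
        congr 2
        exact (sum_range_add_one N).symm
      rw [h3, ← Finset.prod_mul_distrib, ← Finset.prod_range_reflect]
      refine Finset.prod_congr rfl fun i hi => ?_
      obtain ⟨d, rfl⟩ : ∃ d, N = i + 1 + d := ⟨N - (i + 1), by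
        have := Finset.mem_range.1 hi
        omega⟩
      have e1 : i + 1 + d - 1 - i = d := by omega
      rw [e1]
      field_simp
      ring
    rw [two_mul, Finset.prod_range_add, h2]
    have h4 : ∀ i ∈ Finset.range N, 1 + -x / p ^ N * p ^ (N + i) = 1 - x * p ^ i := by
      intro i _
      rw [pow_add]
      field_simp
      ring
    rw [Finset.prod_congr rfl h4]
    ring
  rw [h1] at h
  have hc : (-x) ^ N / p ^ ((N + 1).choose 2) ≠ 0 :=
    div_ne_zero (pow_ne_zero _ hnx) (pow_ne_zero _ hp0)
  refine mul_left_cancel₀ hc (h.trans ?_)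
  rw [Finset.mul_sum]
  refine Finset.sum_congr rfl fun j _ => ?_
  have h5 : p ^ (j.choose 2) * (-x / p ^ N) ^ j
      = (-x) ^ N / p ^ ((N + 1).choose 2)
        * ((-x) ^ ((j : ℤ) - N) * r ^ (((j : ℤ) - N) * (j - N) - (j - N))) := by
    rw [hpdef, pow_choose_two_eq_zpow r, pow_choose_two_eq_zpow r, div_pow, zpow_sub₀ hnx,
      zpow_natCast, zpow_natCast]
    have h6 : ((r ^ 2) ^ N) ^ j = r ^ ((2 : ℤ) * N * j) := by
      rw [← pow_mul, ← pow_mul, ← zpow_natCast]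
      push_cast
      rw [mul_assoc]
    rw [h6]
    have h7 : r ^ ((j : ℤ) * j - j) = r ^ ((2 : ℤ) * N * j)
        * (r ^ (((j : ℤ) - N) * (j - N) - (j - N))
          / r ^ (((N + 1 : ℕ) : ℤ) * (N + 1 : ℕ) - (N + 1 : ℕ))) := by
      rw [← zpow_sub₀ hr, ← zpow_add₀ hr]
      congr 1
      push_cast
      ring
    rw [h7]
    have h8 := zpow_ne_zero ((2 : ℤ) * N * j) hr
    have h9 := pow_ne_zero N hnx
    field_simp
  calc _ = (p ^ (j.choose 2) * (-x / p ^ N) ^ j)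
        * (pochP p (2 * N) / (pochP p j * pochP p (2 * N - j))) := by ring
    _ = _ := by rw [h5]; ring

theorem summable_nat_pow_mul_pow_sq {t r : ℂ} (ht : t ≠ 0) (hr0 : r ≠ 0) (hr : ‖r‖ < 1) :
    Summable fun n : ℕ => ‖t ^ n * r ^ (n * n)‖ := by
  refine summable_of_ratio_test_tendsto_lt_one (l := 0) zero_lt_one
    (.of_forall fun n => ?_) ?_
  · simp [ht, hr0]
  · have h : ∀ n : ℕ, ‖‖t ^ (n + 1) * r ^ ((n + 1) * (n + 1))‖‖ / ‖‖t ^ n * r ^ (n * n)‖‖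
        = ‖t * r‖ * ‖r ^ 2‖ ^ n := by
      intro n
      rw [norm_norm, norm_norm, ← norm_div, ← norm_pow, ← norm_mul]
      congr 1
      have h1 := pow_ne_zero n ht
      have h2 := pow_ne_zero (n * n) hr0
      field_simp
      ring
    simp_rw [h]
    have h3 := norm_sq_lt_one hr
    simpa using (tendsto_pow_atTop_nhds_zero_of_lt_one (norm_nonneg _) h3).const_mul ‖t * r‖

/-- Absolute convergence of a bilateral theta series. -/
theorem summable_norm_zpow_mul_zpow_sq {t r : ℂ} (ht : t ≠ 0) (hr0 : r ≠ 0) (hr : ‖r‖ < 1) :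
    Summable fun k : ℤ => ‖t ^ k * r ^ (k * k)‖ := by
  apply Summable.of_nat_of_neg
  · refine (summable_nat_pow_mul_pow_sq ht hr0 hr).congr fun n => ?_
    congr 1
  · refine (summable_nat_pow_mul_pow_sq (inv_ne_zero ht) hr0 hr).congr fun n => ?_
    rw [zpow_neg, zpow_natCast, inv_pow, neg_mul_neg]
    congr 1

theorem summable_norm_theta_term {x r : ℂ} (hx : x ≠ 0) (hr0 : r ≠ 0) (hr : ‖r‖ < 1) :
    Summable fun k : ℤ => ‖x ^ k * r ^ (k * k - k)‖ := by
  refine (summable_norm_zpow_mul_zpow_sq (div_ne_zero hx hr0) hr0 hr).congr fun k => ?_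
  rw [zpow_sub₀ hr0, div_zpow]
  congr 1
  ring

theorem tendsto_pochP {p : ℂ} (hp : ‖p‖ < 1) :
    Tendsto (pochP p) atTop (𝓝 (qFacInf p p)) := by
  have h := (multipliable_qFacInf p hp).hasProd.tendsto_prod_nat
  refine h.congr fun n => Finset.prod_congr rfl fun i _ => ?_
  rw [pow_succ']

theorem qFacInf_self_ne_zero {p : ℂ} (hp : ‖p‖ < 1) : qFacInf p p ≠ 0 := by
  intro h
  obtain ⟨j, hj⟩ := (qFacInf_eq_zero_iff p hp).1 h
  exact one_sub_pow_ne_zero hp j (by rw [pow_succ', hj, sub_self])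

/-- The Jacobi triple product, with nome `r ^ 2`. -/
theorem triple_product {r x : ℂ} (hr0 : r ≠ 0) (hr : ‖r‖ < 1) (hx : x ≠ 0) :
    ellTheta x (r ^ 2) * qFacInf (r ^ 2) (r ^ 2) = ∑' k : ℤ, (-x) ^ k * r ^ (k * k - k) := by
  have hp := norm_sq_lt_one hr
  set p := r ^ 2 with hpdef
  have hL := qFacInf_self_ne_zero hp
  set L := qFacInf p p with hLdef
  -- The finite product is the series with its terms multiplied by `G N k`, a quotient of
  -- Pochhammer symbols extended by zero. It is bounded and tends to `1 / L`, so that dominated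
  -- convergence applies.
  set s : ℤ → ℂ := fun k => (-x) ^ k * r ^ (k * k - k) with hs
  set G : ℕ → ℤ → ℂ := fun N k => if -(N : ℤ) ≤ k ∧ k ≤ N then
    pochP p (2 * N) / (pochP p (k + N).toNat * pochP p (2 * N - (k + N).toNat)) else 0 with hG
  have hfin : ∀ N : ℕ, (∏ i ∈ Finset.range N, (1 - x * p ^ i))
      * ∏ i ∈ Finset.range N, (1 - p / x * p ^ i) = ∑' k : ℤ, s k * G N k := by
    intro N
    rw [finite_triple_product hr0 hp hx N,
      tsum_eq_sum (s := (Finset.range (2 * N + 1)).image fun j : ℕ => (j : ℤ) - N),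
      Finset.sum_image fun i _ j _ h => by simpa using h]
    · refine Finset.sum_congr rfl fun j hj => ?_
      have hj := Finset.mem_range.1 hj
      have h1 : -(N : ℤ) ≤ (j : ℤ) - N ∧ (j : ℤ) - N ≤ N := by omega
      simp only [hs, hG]
      rw [if_pos h1]
      have h2 : ((j : ℤ) - N + N).toNat = j := by omega
      rw [h2]
    · intro k hk
      have h1 : ¬ (-(N : ℤ) ≤ k ∧ k ≤ N) := by
        intro h
        apply hk
        rw [Finset.mem_image]
        exact ⟨(k + N).toNat, Finset.mem_range.2 (by omega), by omega⟩
      simp only [hG]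
      rw [if_neg h1, mul_zero]
  have hpo := tendsto_pochP hp
  obtain ⟨C, hC⟩ := (Metric.isBounded_range_of_tendsto _ hpo).exists_norm_le
  obtain ⟨C', hC'⟩ := (Metric.isBounded_range_of_tendsto _ (hpo.inv₀ hL)).exists_norm_le
  have hC : ∀ n, ‖pochP p n‖ ≤ C := fun n => hC _ ⟨n, rfl⟩
  have hC' : ∀ n, ‖(pochP p n)⁻¹‖ ≤ C' := fun n => hC' _ ⟨n, rfl⟩
  have hC0 : 0 ≤ C := (norm_nonneg _).trans (hC 0)
  have hC0' : 0 ≤ C' := (norm_nonneg _).trans (hC' 0)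
  have hlim : Tendsto (fun N => ∑' k : ℤ, s k * G N k) atTop (𝓝 (∑' k : ℤ, s k * L⁻¹)) := by
    refine tendsto_tsum_of_dominated_convergence (bound := fun k => ‖s k‖ * (C * (C' * C')))
      ((summable_norm_theta_term (neg_ne_zero.2 hx) hr0 hr).mul_right _) (fun k => ?_)
      (.of_forall fun N k => ?_)
    · refine Tendsto.const_mul _ ?_
      have h1 : Tendsto (fun N : ℕ => 2 * N) atTop atTop :=
        tendsto_atTop_atTop.2 fun b => ⟨b, fun N hN => by omega⟩
      have h2 : Tendsto (fun N : ℕ => (k + N).toNat) atTop atTop :=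
        tendsto_atTop_atTop.2 fun b => ⟨b + k.natAbs, fun N hN => by omega⟩
      have h3 : Tendsto (fun N : ℕ => 2 * N - (k + N).toNat) atTop atTop :=
        tendsto_atTop_atTop.2 fun b => ⟨b + k.natAbs, fun N hN => by omega⟩
      have h4 := (hpo.comp h1).div ((hpo.comp h2).mul (hpo.comp h3)) (mul_ne_zero hL hL)
      have h5 : L / (L * L) = L⁻¹ := by field_simp
      rw [h5] at h4
      refine h4.congr' ?_
      filter_upwards [eventually_ge_atTop k.natAbs] with N hN
      have h6 : -(N : ℤ) ≤ k ∧ k ≤ N := by omega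
      simp only [hG]
      rw [if_pos h6]
      rfl
    · rw [norm_mul]
      refine mul_le_mul_of_nonneg_left ?_ (norm_nonneg _)
      simp only [hG]
      split_ifs with h
      · rw [div_eq_mul_inv, mul_inv, norm_mul, norm_mul]
        exact mul_le_mul (hC _) (mul_le_mul (hC' _) (hC' _) (norm_nonneg _) hC0')
          (by positivity) hC0
      · rw [norm_zero]
        positivity
  have hprod : Tendsto (fun N => (∏ i ∈ Finset.range N, (1 - x * p ^ i))
      * ∏ i ∈ Finset.range N, (1 - p / x * p ^ i)) atTop (𝓝 (ellTheta x p)) :=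
    (multipliable_qFacInf x hp).hasProd.tendsto_prod_nat.mul
      (multipliable_qFacInf (p / x) hp).hasProd.tendsto_prod_nat
  have h := tendsto_nhds_unique (hprod.congr hfin) hlim
  rw [h, tsum_mul_right, inv_mul_cancel_right₀ hL]

/-! ### The theta function as a determinant -/

/-- Pairs of integers are split according to the parity of their sum. -/
def intPairEquiv : (ℤ × ℤ) ⊕ (ℤ × ℤ) ≃ ℤ × ℤ where
  toFun := Sum.elim (fun u => (u.1 + u.2, u.1 - u.2)) fun u => (u.1 + u.2 + 1, u.1 - u.2)
  invFun v := if (v.1 + v.2) % 2 = 0 then Sum.inl ((v.1 + v.2) / 2, (v.1 - v.2) / 2)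
    else Sum.inr ((v.1 + v.2 - 1) / 2, (v.1 - v.2 - 1) / 2)
  left_inv u := by
    rcases u with ⟨i, j⟩ | ⟨i, j⟩
    · have h : (i + j + (i - j)) % 2 = 0 := by omega
      simp only [Sum.elim_inl, h, if_true, Sum.inl.injEq, Prod.mk.injEq]
      omega
    · have h : ¬ (i + j + 1 + (i - j)) % 2 = 0 := by omega
      simp only [Sum.elim_inr, h, if_false, Sum.inr.injEq, Prod.mk.injEq]
      omega
  right_inv v := by
    rcases v with ⟨m, n⟩
    by_cases h : (m + n) % 2 = 0
    · simp only [h, if_true, Sum.elim_inl, Prod.mk.injEq]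
      omega
    · simp only [h, if_false, Sum.elim_inr, Prod.mk.injEq]
      omega

/-- `θ(xy)θ(x/y)` is, up to the factor `x`, a `2 × 2` determinant in a pair of functions of `x`
and the same pair of functions of `y`. Every relation among products of theta functions used
below is thereby a polynomial identity. -/
theorem exists_ellTheta_det {p : ℂ} (hp : ‖p‖ < 1) :
    ∃ f g : ℂ → ℂ, (∀ x, f (-x) = -f x) ∧ (∀ x, g (-x) = g x) ∧
      ∀ x y, x ≠ 0 → y ≠ 0 →
        ellTheta (x * y) p * ellTheta (x / y) p = x * (f x * g y - g x * f y) := by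
  rcases eq_or_ne p 0 with rfl | hp0
  · refine ⟨fun x => x + 1 / x, fun _ => 1, fun x => by ring, fun _ => rfl, fun x y hx hy => ?_⟩
    rw [ellTheta_zero, ellTheta_zero]
    field_simp
    ring
  obtain ⟨r, rfl⟩ : ∃ r, p = r ^ 2 := ⟨p ^ (1 / 2 : ℂ), by
    rw [← Complex.cpow_nat_mul]
    norm_num⟩
  have hr0 : r ≠ 0 := by
    rintro rfl
    simp at hp0
  have hr : ‖r‖ < 1 := by
    rw [norm_pow] at hp
    by_contra! h
    exact absurd hp (not_lt.2 (one_le_pow₀ h))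
  have hL := qFacInf_self_ne_zero hp
  set L := qFacInf (r ^ 2) (r ^ 2)
  set B : ℂ → ℂ := fun y => ∑' j : ℤ, (y ^ 2) ^ j * (r ^ 2) ^ (j * j) with hB
  set D : ℂ → ℂ := fun y => ∑' j : ℤ, y * ((y ^ 2) ^ j * (r ^ 2) ^ (j * j + j)) with hD
  refine ⟨fun x => D x / L, fun x => B x / L, fun x => ?_, fun x => ?_, fun x y hx hy => ?_⟩
  · simp only [hD, even_two.neg_pow, neg_mul, tsum_neg, neg_div]
  · simp only [hB, even_two.neg_pow]
  have sumB : ∀ y : ℂ, y ≠ 0 → Summable fun j : ℤ => ‖(y ^ 2) ^ j * (r ^ 2) ^ (j * j)‖ :=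
    fun y hy => summable_norm_zpow_mul_zpow_sq (pow_ne_zero 2 hy) hp0 hp
  have sumD : ∀ y : ℂ, y ≠ 0 →
      Summable fun j : ℤ => ‖y * ((y ^ 2) ^ j * (r ^ 2) ^ (j * j + j))‖ := by
    intro y hy
    refine ((summable_norm_zpow_mul_zpow_sq (mul_ne_zero (pow_ne_zero 2 hy) hp0) hp0 hp).mul_left
      ‖y‖).congr fun j => ?_
    rw [zpow_add₀ hp0, mul_zpow, ← norm_mul]
    congr 1
    ring
  -- Both factors are expanded by the triple product. In the double series the index pairs with even
  -- and with odd sum are collected separately, and in each of the two parts the variables separate.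
  have h1 := triple_product hr0 hr (mul_ne_zero hx hy)
  have h2 := triple_product hr0 hr (div_ne_zero hx hy)
  have hS1 := summable_norm_theta_term (neg_ne_zero.2 (mul_ne_zero hx hy)) hr0 hr
  have hS2 := summable_norm_theta_term (neg_ne_zero.2 (div_ne_zero hx hy)) hr0 hr
  have h3 := tsum_mul_tsum_of_summable_norm hS1 hS2
  have hS := summable_mul_of_summable_norm hS1 hS2
  rw [← h1, ← h2, ← intPairEquiv.tsum_eq] at h3
  have hS' := intPairEquiv.summable_iff.2 hS
  have hinl : ∀ u : ℤ × ℤ, (-(x * y)) ^ (u.1 + u.2) * r ^ ((u.1 + u.2) * (u.1 + u.2) - (u.1 + u.2))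
        * ((-(x / y)) ^ (u.1 - u.2) * r ^ ((u.1 - u.2) * (u.1 - u.2) - (u.1 - u.2)))
      = ((x ^ 2) ^ u.1 * (r ^ 2) ^ (u.1 * u.1 - u.1))
        * ((y ^ 2) ^ u.2 * (r ^ 2) ^ (u.2 * u.2)) := by
    rintro ⟨i, j⟩
    have e1 : (-(x * y)) ^ (i + j) * (-(x / y)) ^ (i - j) = (x ^ 2) ^ i * (y ^ 2) ^ j := by
      have hxy : -(x * y) ≠ 0 := neg_ne_zero.2 (mul_ne_zero hx hy)
      have hxy' : -(x / y) ≠ 0 := neg_ne_zero.2 (div_ne_zero hx hy)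
      rw [zpow_add₀ hxy, zpow_sub₀ hxy']
      calc _ = (-(x * y) * -(x / y)) ^ i * (-(x * y) / -(x / y)) ^ j := by
            rw [mul_zpow, div_zpow]; ring
        _ = _ := by
            congr 2 <;> field_simp
    have e2 : r ^ ((i + j) * (i + j) - (i + j)) * r ^ ((i - j) * (i - j) - (i - j))
        = (r ^ 2) ^ (i * i - i) * (r ^ 2) ^ (j * j) := by
      rw [← zpow_add₀ hr0, ← zpow_natCast r 2, ← zpow_mul, ← zpow_mul, ← zpow_add₀ hr0]
      congr 1
      push_cast
      ring
    calc _ = ((-(x * y)) ^ (i + j) * (-(x / y)) ^ (i - j))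
          * (r ^ ((i + j) * (i + j) - (i + j)) * r ^ ((i - j) * (i - j) - (i - j))) := by ring
      _ = _ := by rw [e1, e2]; ring
  have hinr : ∀ u : ℤ × ℤ, (-(x * y)) ^ (u.1 + u.2 + 1)
          * r ^ ((u.1 + u.2 + 1) * (u.1 + u.2 + 1) - (u.1 + u.2 + 1))
        * ((-(x / y)) ^ (u.1 - u.2) * r ^ ((u.1 - u.2) * (u.1 - u.2) - (u.1 - u.2)))
      = -x * ((x ^ 2) ^ u.1 * (r ^ 2) ^ (u.1 * u.1))
          * (y * ((y ^ 2) ^ u.2 * (r ^ 2) ^ (u.2 * u.2 + u.2))) := by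
    rintro ⟨i, j⟩
    have e1 : (-(x * y)) ^ (i + j + 1) * (-(x / y)) ^ (i - j)
        = -(x * y) * ((x ^ 2) ^ i * (y ^ 2) ^ j) := by
      have hxy : -(x * y) ≠ 0 := neg_ne_zero.2 (mul_ne_zero hx hy)
      have hxy' : -(x / y) ≠ 0 := neg_ne_zero.2 (div_ne_zero hx hy)
      rw [zpow_add₀ hxy, zpow_add₀ hxy, zpow_sub₀ hxy', zpow_one]
      calc _ = -(x * y) * ((-(x * y) * -(x / y)) ^ i * (-(x * y) / -(x / y)) ^ j) := by
            rw [mul_zpow, div_zpow]; ring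
        _ = _ := by
            congr 3 <;> field_simp
    have e2 : r ^ ((i + j + 1) * (i + j + 1) - (i + j + 1)) * r ^ ((i - j) * (i - j) - (i - j))
        = (r ^ 2) ^ (i * i) * (r ^ 2) ^ (j * j + j) := by
      rw [← zpow_add₀ hr0, ← zpow_natCast r 2, ← zpow_mul, ← zpow_mul, ← zpow_add₀ hr0]
      congr 1
      push_cast
      ring
    calc _ = ((-(x * y)) ^ (i + j + 1) * (-(x / y)) ^ (i - j))
          * (r ^ ((i + j + 1) * (i + j + 1) - (i + j + 1))
            * r ^ ((i - j) * (i - j) - (i - j))) := by ring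
      _ = _ := by rw [e1, e2]; ring
  have hshift : ∑' i : ℤ, (x ^ 2) ^ i * (r ^ 2) ^ (i * i - i) = x * D x := by
    rw [← (Equiv.addRight (1 : ℤ)).tsum_eq, hD]
    simp only [Equiv.coe_addRight]
    rw [← tsum_mul_left]
    refine tsum_congr fun i => ?_
    have h4 : (i + 1) * (i + 1) - (i + 1) = i * i + i := by ring
    rw [h4, zpow_add₀ (pow_ne_zero 2 hx), zpow_one]
    ring
  have sumA : Summable fun i : ℤ => ‖(x ^ 2) ^ i * (r ^ 2) ^ (i * i - i)‖ :=
    summable_norm_theta_term (pow_ne_zero 2 hx) hp0 hp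
  have h5 : ∑' c, ((-(x * y)) ^ (intPairEquiv c).1
        * r ^ ((intPairEquiv c).1 * (intPairEquiv c).1 - (intPairEquiv c).1)
        * ((-(x / y)) ^ (intPairEquiv c).2
          * r ^ ((intPairEquiv c).2 * (intPairEquiv c).2 - (intPairEquiv c).2)))
      = x * D x * B y - x * B x * D y := by
    refine (Summable.tsum_sum (hS'.comp_injective Sum.inl_injective)
      (hS'.comp_injective Sum.inr_injective)).trans ?_
    simp only [Function.comp_apply, intPairEquiv, Equiv.coe_fn_mk, Sum.elim_inl, Sum.elim_inr]
    rw [tsum_congr hinl, tsum_congr hinr, ← tsum_mul_tsum_of_summable_norm sumA (sumB y hy),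
      hshift, ← tsum_mul_tsum_of_summable_norm
        (f := fun i : ℤ => -x * ((x ^ 2) ^ i * (r ^ 2) ^ (i * i)))
        (by simpa only [norm_mul, norm_neg] using (sumB x hx).mul_left ‖x‖) (sumD y hy),
      tsum_mul_left]
    ring
  rw [h5] at h3
  field_simp
  linear_combination h3

/-! ### Theta function identities -/

theorem exists_sq_eq {b : ℂ} (hb : b ≠ 0) : ∃ x, x ≠ 0 ∧ b = x ^ 2 := by
  obtain ⟨x, rfl⟩ := IsAlgClosed.exists_pow_nat_eq b two_pos
  exact ⟨x, by rintro rfl; simp at hb, rfl⟩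

/-- The three-term addition formula (Weierstrass), arranged as the difference of two products of
four theta functions of the kind occurring in summations of well-poised series. -/
theorem ellTheta_add {p A b c d : ℂ} (hp : ‖p‖ < 1) (hA : A ≠ 0) (hb : b ≠ 0) (hc : c ≠ 0)
    (hd : d ≠ 0) :
    ellTheta A p * ellTheta (A / (b * c)) p * (ellTheta (A / (b * d)) p * ellTheta (A / (c * d)) p)
      - ellTheta (A / b) p * ellTheta (A / c) p
        * (ellTheta (A / d) p * ellTheta (A / (b * c * d)) p)
      = A / (b * c * d) * (ellTheta b p * ellTheta c p
        * (ellTheta d p * ellTheta (A ^ 2 / (b * c * d)) p)) := by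
  obtain ⟨f, g, -, -, hdet⟩ := exists_ellTheta_det hp
  obtain ⟨x, hx, rfl⟩ := exists_sq_eq hb
  obtain ⟨y, hy, rfl⟩ := exists_sq_eq hc
  -- The products are the six determinants of the points `u = A/(xy)`, `v = A/(dxy)`, `xy`, `x/y`.
  have hu : A / (x * y) ≠ 0 := div_ne_zero hA (mul_ne_zero hx hy)
  have hv : A / (d * x * y) ≠ 0 := div_ne_zero hA (mul_ne_zero (mul_ne_zero hd hx) hy)
  have hP : x * y ≠ 0 := mul_ne_zero hx hy
  have hR : x / y ≠ 0 := div_ne_zero hx hy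
  have h1 := hdet _ _ hu hP
  have h2 := hdet _ _ hv hR
  have h3 := hdet _ _ hu hR
  have h4 := hdet _ _ hv hP
  have h5 := hdet _ _ hP hR
  have h6 := hdet _ _ hu hv
  rw [show A / (x * y) * (x * y) = A by field_simp,
    show A / (x * y) / (x * y) = A / (x ^ 2 * y ^ 2) by field_simp] at h1
  rw [show A / (d * x * y) * (x / y) = A / (y ^ 2 * d) by field_simp,
    show A / (d * x * y) / (x / y) = A / (x ^ 2 * d) by field_simp] at h2
  rw [show A / (x * y) * (x / y) = A / y ^ 2 by field_simp,
    show A / (x * y) / (x / y) = A / x ^ 2 by field_simp] at h3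
  rw [show A / (d * x * y) * (x * y) = A / d by field_simp,
    show A / (d * x * y) / (x * y) = A / (x ^ 2 * y ^ 2 * d) by field_simp] at h4
  rw [show x * y * (x / y) = x ^ 2 by field_simp,
    show x * y / (x / y) = y ^ 2 by field_simp] at h5
  rw [show A / (x * y) * (A / (d * x * y)) = A ^ 2 / (x ^ 2 * y ^ 2 * d) by field_simp,
    show A / (x * y) / (A / (d * x * y)) = d by field_simp] at h6
  rw [h1, mul_comm (ellTheta (A / (x ^ 2 * d)) p), h2, mul_comm (ellTheta (A / x ^ 2) p), h3, h4,
    h5, mul_comm (ellTheta d p), h6]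
  field_simp
  ring

/-- A four-term identity involving the duplicated argument `-xyz²`. It is a consequence of the
addition formula, the points involved being `±s`, `±sz` and `t`, where `x = st` and `y = s/t`. -/
theorem ellTheta_duplication {p x y z : ℂ} (hp : ‖p‖ < 1) (hx : x ≠ 0) (hy : y ≠ 0) (hz : z ≠ 0) :
    z * (ellTheta (-(x * y * z ^ 2)) p * ellTheta (-1) p)
        * ((ellTheta x p * ellTheta y p) * (ellTheta (-x) p * ellTheta (-y) p))
      + ellTheta (-(x * y)) p * ellTheta (-1) p
        * ((ellTheta (x * z) p * ellTheta (y * z) p)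
          * (ellTheta (-(x * z)) p * ellTheta (-(y * z)) p))
      = ellTheta (-(x * y * z)) p * ellTheta (-z) p
        * ((ellTheta (x * z) p * ellTheta (y * z) p) * (ellTheta (-x) p * ellTheta (-y) p)
          + (ellTheta (-(x * z)) p * ellTheta (-(y * z)) p)
            * (ellTheta x p * ellTheta y p)) := by
  obtain ⟨f, g, hf, hg, hdet⟩ := exists_ellTheta_det hp
  obtain ⟨s, hs, hxy⟩ := exists_sq_eq (mul_ne_zero hx hy)
  obtain ⟨t, ht, rfl⟩ : ∃ t, t ≠ 0 ∧ x = s * t := ⟨x / s, div_ne_zero hx hs, by field_simp⟩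
  obtain rfl : y = s / t := by
    field_simp
    apply mul_left_cancel₀ hs
    linear_combination hxy
  have hY : s * z ≠ 0 := mul_ne_zero hs hz
  have h1 := hdet _ _ hY (neg_ne_zero.2 hY)
  have h2 := hdet _ _ hs (neg_ne_zero.2 hs)
  have h3 := hdet _ _ hs ht
  have h4 := hdet _ _ (neg_ne_zero.2 hs) ht
  have h5 := hdet _ _ hY ht
  have h6 := hdet _ _ (neg_ne_zero.2 hY) ht
  have h7 := hdet _ _ (neg_ne_zero.2 hY) hs
  rw [show s * z * -(s * z) = -(s * t * (s / t) * z ^ 2) by field_simp,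
    show s * z / -(s * z) = -1 by field_simp] at h1
  rw [show s * -s = -(s * t * (s / t)) by field_simp, show s / -s = -1 by field_simp] at h2
  rw [show -s * t = -(s * t) by ring, show -s / t = -(s / t) by ring] at h4
  rw [show s * z * t = s * t * z by ring, show s * z / t = s / t * z by ring] at h5
  rw [show -(s * z) * t = -(s * t * z) by ring, show -(s * z) / t = -(s / t * z) by ring] at h6
  rw [show -(s * z) * s = -(s * t * (s / t) * z) by field_simp,
    show -(s * z) / s = -z by field_simp] at h7
  rw [h1, h2, h3, h4, h5, h6, h7]
  simp only [hf, hg]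
  ring

/-! ### The Frenkel–Turaev sum -/

/-- The `k`-th term of the very-well-poised elliptic hypergeometric series with base parameter `a`
and further parameters `b, c, d, e, f`. Neither the balancing condition nor termination is part of
the definition. -/
noncomputable def vwpTerm (a b c d e f q p : ℂ) (k : ℕ) : ℂ :=
  ellTheta (a * q ^ (2 * k)) p / ellTheta a p
    * ((ellFac a q p k * ellFac b q p k * ellFac c q p k * ellFac d q p k * ellFac e q p k
        * ellFac f q p k)
      / (ellFac q q p k * ellFac (a * q / b) q p k * ellFac (a * q / c) q p k
        * ellFac (a * q / d) q p k * ellFac (a * q / e) q p k * ellFac (a * q / f) q p k))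
    * q ^ k

/-- The right-hand side of the Frenkel–Turaev sum. The parameter `e` does not occur, since it is
determined by the balancing condition `bcde = a²q^{n+1}`. -/
noncomputable def ftProduct (a b c d q p : ℂ) (n : ℕ) : ℂ :=
  (ellFac (a * q) q p n * ellFac (a * q / (b * c)) q p n * ellFac (a * q / (b * d)) q p n
      * ellFac (a * q / (c * d)) q p n)
    / (ellFac (a * q / b) q p n * ellFac (a * q / c) q p n * ellFac (a * q / d) q p n
      * ellFac (a * q / (b * c * d)) q p n)

theorem vwpTerm_zero {a b c d e f q p : ℂ} (ha : ellTheta a p ≠ 0) :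
    vwpTerm a b c d e f q p 0 = 1 := by
  simp [vwpTerm, ellFac_zero, ha]

theorem ellTheta_one (p : ℂ) : ellTheta 1 p = 0 := by
  rw [ellTheta, qFacInf, tprod_of_exists_eq_zero ⟨0, by simp⟩, zero_mul]

theorem ellFac_one_div_pow_eq_zero {q : ℂ} (hq : q ≠ 0) (p : ℂ) {n k : ℕ} (h : n < k) :
    ellFac (1 / q ^ n) q p k = 0 := by
  refine Finset.prod_eq_zero (Finset.mem_range.2 h) ?_
  rw [one_div_mul_cancel (pow_ne_zero n hq), ellTheta_one]

/-- The rational identity behind `vwpTerm_contiguous`. -/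
theorem contiguous_rational_identity {w X1 X2 X3 X4 X5 X6 X7 X8 X9 Y0 Y1 Y2 Y5 Z0 N M : ℂ}
    (X0 : ℂ) (hZ0 : Z0 ≠ 0) (hY1 : Y1 ≠ 0) (hY2 : Y2 ≠ 0) (hX2 : X2 ≠ 0) (hX3 : X3 ≠ 0)
    (hX8 : X8 ≠ 0) (hY5 : Y5 ≠ 0)
    (key : X1 * X2 * (X3 * X4) - X5 * X6 * (X7 * X8) = w * (X9 * Y0 * (Y1 * Y2))) :
    X0 / Z0 * (Z0 * N * X1 * X4 / (Y2 * Y1 * (X8 * M / X2)))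
      - X0 / Z0 * (Z0 * N * X7 * X6 / (Y2 * Y1 * (M * X3 / X5)))
    = w * X9 * Y0 / (X8 * X3) * (X0 / Y5) * Y5 * N / M := by
  rcases eq_or_ne M 0 with rfl | hM
  · simp
  trans X0 * N / (Y1 * Y2 * X8 * X3 * M) * (X1 * X2 * (X3 * X4) - X5 * X6 * (X7 * X8))
  · rw [mul_sub]
    congr 1
    · field_simp
    · field_simp
  · rw [key]
    field_simp

/-- The contiguous relation behind the induction for the Frenkel–Turaev sum: raising `n` by one
and `e/q` to `e`, as the balancing condition requires, changes the `(i+1)`-st term by a multiple,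
independent of `i`, of the `i`-th term of the series with `a, b, c, d` replaced by
`aq², bq, cq, dq`. -/
theorem vwpTerm_contiguous {a b c d e q p : ℂ} {n i : ℕ} (hp : ‖p‖ < 1) (hq : q ≠ 0)
    (ha : a ≠ 0) (he : e ≠ 0)
    (hA : ∀ i : ℕ, ellTheta (a * q ^ i) p ≠ 0)
    (hQ : ellTheta (q ^ (i + 1)) p ≠ 0)
    (hE : ∀ j : ℕ, ellTheta (a * q ^ (j + 1) / e) p ≠ 0) :
    vwpTerm a b c d e (1 / q ^ (n + 1)) q p (i + 1)
      - vwpTerm a b c d (e / q) (1 / q ^ n) q p (i + 1)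
    = (ellTheta (a * q) p * ellTheta (a * q ^ 2) p * ellTheta b p * ellTheta c p * ellTheta d p
        * ellTheta (e / (a * q ^ (n + 2))) p * ellTheta (e * q ^ n) p * (a * q ^ 2 / e))
      / (ellTheta (a * q / b) p * ellTheta (a * q / c) p * ellTheta (a * q / d) p
        * ellTheta (a * q / e) p * ellTheta (a * q ^ 2 / e) p * ellTheta (a * q ^ (n + 1)) p
        * ellTheta (a * q ^ (n + 2)) p)
      * vwpTerm (a * q ^ 2) (b * q) (c * q) (d * q) e (1 / q ^ n) q p i := by
  have hqi := pow_ne_zero i hq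
  have hqn := pow_ne_zero n hq
  -- The `i`-dependent factors of the three terms of the relation are those of one instance of the
  -- addition formula; all others are common to the three terms.
  have key := ellTheta_add (p := p) (A := e * q ^ i) (b := e / (a * q ^ (n + 2))) (c := e * q ^ n)
    (d := q ^ (i + 1)) hp (mul_ne_zero he hqi)
    (div_ne_zero he (mul_ne_zero ha (pow_ne_zero _ hq))) (mul_ne_zero he hqn) (pow_ne_zero _ hq)
  rw [show e * q ^ i / (e / (a * q ^ (n + 2)) * (e * q ^ n)) = a * q ^ (i + 2) / e by
      field_simp; ring,
    show e * q ^ i / (e / (a * q ^ (n + 2)) * q ^ (i + 1)) = a * q ^ (n + 1) by field_simp; ring,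
    show e * q ^ i / (e * q ^ n * q ^ (i + 1)) = 1 / q ^ (n + 1) by field_simp; ring,
    show e * q ^ i / (e / (a * q ^ (n + 2))) = a * q ^ (n + 2) * q ^ i by field_simp,
    show e * q ^ i / (e * q ^ n) = 1 / q ^ n * q ^ i by field_simp,
    show e * q ^ i / q ^ (i + 1) = e / q by field_simp; ring,
    show e * q ^ i / (e / (a * q ^ (n + 2)) * (e * q ^ n) * q ^ (i + 1)) = a * q / e by
      field_simp; ring,
    show (e * q ^ i) ^ 2 / (e / (a * q ^ (n + 2)) * (e * q ^ n) * q ^ (i + 1))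
      = a * q ^ (i + 1) by field_simp; ring] at key
  have sA : ellFac a q p (i + 1) * ellTheta (a * q ^ (i + 1)) p
      = ellTheta a p * ellTheta (a * q) p * ellFac (a * q ^ 2) q p i := by
    rw [← ellFac_succ, ellFac_succ', ellFac_succ']
    ring_nf
  have sB : ∀ x, ellFac x q p (i + 1) = ellTheta x p * ellFac (x * q) q p i :=
    fun x => ellFac_succ' x q p i
  have sB' : ∀ x, ellFac (a * q / x) q p (i + 1)
      = ellTheta (a * q / x) p * ellFac (a * q ^ 2 / x) q p i := by
    intro x
    rw [ellFac_succ']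
    ring_nf
  have sE : ellTheta (a * q ^ 2 / e) p * ellFac (a * q ^ 3 / e) q p i
      = ellFac (a * q ^ 2 / e) q p i * ellTheta (a * q ^ (i + 2) / e) p := by
    rw [show a * q ^ (i + 2) / e = a * q ^ 2 / e * q ^ i by ring, ← ellFac_succ, ellFac_succ',
      show a * q ^ 2 / e * q = a * q ^ 3 / e by ring]
  have sF : ellTheta (a * q ^ (n + 2)) p * ellFac (a * q ^ (n + 3)) q p i
      = ellFac (a * q ^ (n + 2)) q p i * ellTheta (a * q ^ (n + 2) * q ^ i) p := by
    rw [← ellFac_succ, ellFac_succ']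
    ring_nf
  have nE : ellTheta (a * q / e) p ≠ 0 := by simpa using hE 0
  have nE3 : ellTheta (a * q ^ (i + 2) / e) p ≠ 0 := hE (i + 1)
  have nF2 : ellTheta (a * q ^ (n + 2) * q ^ i) p ≠ 0 := by
    rw [mul_assoc, ← pow_add]
    exact hA _
  have n0 : ellTheta a p ≠ 0 := by simpa using hA 0
  have n1 : ellTheta (a * q ^ (i + 1)) p ≠ 0 := hA _
  have n2 := hA 2
  have n3 := hA (n + 1)
  unfold vwpTerm
  rw [show a * q / (1 / q ^ (n + 1)) = a * q ^ (n + 2) by field_simp; ring,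
    show a * q / (1 / q ^ n) = a * q ^ (n + 1) by field_simp; ring,
    show a * q / (e / q) = a * q ^ 2 / e by field_simp,
    show a * q ^ 2 * q / (1 / q ^ n) = a * q ^ (n + 3) by field_simp; ring,
    show a * q ^ 2 * q / (b * q) = a * q ^ 2 / b by field_simp,
    show a * q ^ 2 * q / (c * q) = a * q ^ 2 / c by field_simp,
    show a * q ^ 2 * q / (d * q) = a * q ^ 2 / d by field_simp,
    show a * q ^ 2 * q / e = a * q ^ 3 / e by ring,
    show a * q ^ (2 * (i + 1)) = a * q ^ 2 * q ^ (2 * i) by ring,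
    sB b, sB c, sB d, sB' b, sB' c, sB' d, sB' e, ellFac_succ e, sB (e / q),
    div_mul_cancel₀ e hq, sB (1 / q ^ (n + 1)),
    show 1 / q ^ (n + 1) * q = 1 / q ^ n by field_simp; ring,
    ellFac_succ (1 / q ^ n), ellFac_succ (a * q ^ (n + 2)), sB (a * q ^ (n + 1)),
    show a * q ^ (n + 1) * q = a * q ^ (n + 2) by ring, ellFac_succ (a * q ^ 2 / e),
    ellFac_succ q, ← pow_succ' q i, show a * q ^ 2 / e * q ^ i = a * q ^ (i + 2) / e by ring,
    eq_div_of_mul_eq n1 sA, eq_div_of_mul_eq nE3 sE.symm, eq_div_of_mul_eq nF2 sF.symm]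
  clear sA sB sB' sE sF hA hE
  generalize ellTheta (a * q ^ 2 * q ^ (2 * i)) p = X0 at *
  generalize ellTheta (e * q ^ i) p = X1 at *
  generalize ellTheta (a * q ^ (i + 2) / e) p = X2 at *
  generalize ellTheta (a * q ^ (n + 1)) p = X3 at *
  generalize ellTheta (1 / q ^ (n + 1)) p = X4 at *
  generalize ellTheta (a * q ^ (n + 2) * q ^ i) p = X5 at *
  generalize ellTheta (1 / q ^ n * q ^ i) p = X6 at *
  generalize ellTheta (e / q) p = X7 at *
  generalize ellTheta (a * q / e) p = X8 at *
  generalize ellTheta (e / (a * q ^ (n + 2))) p = X9 at *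
  generalize ellTheta (e * q ^ n) p = Y0 at *
  generalize ellTheta (q ^ (i + 1)) p = Y1 at *
  generalize ellTheta (a * q ^ (i + 1)) p = Y2 at *
  generalize ellTheta (a * q ^ (n + 2)) p = Y3 at *
  generalize ellTheta (a * q) p = Y4 at *
  generalize ellTheta (a * q ^ 2) p = Y5 at *
  generalize ellTheta (a * q ^ 2 / e) p = Y6 at *
  generalize ellTheta a p = Z0 at *
  generalize ellFac (a * q ^ 2) q p i = Z2 at *
  rw [div_mul_cancel₀ _ nF2, div_mul_cancel₀ _ nE3]
  have h := contiguous_rational_identity (N := Y4 * Z2 * (ellTheta b p * ellFac (b * q) q p i)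
      * (ellTheta c p * ellFac (c * q) q p i) * (ellTheta d p * ellFac (d * q) q p i)
      * ellFac e q p i * ellFac (1 / q ^ n) q p i * q ^ (i + 1))
    (M := ellFac q q p i * (ellTheta (a * q / b) p * ellFac (a * q ^ 2 / b) q p i)
      * (ellTheta (a * q / c) p * ellFac (a * q ^ 2 / c) q p i)
      * (ellTheta (a * q / d) p * ellFac (a * q ^ 2 / d) q p i)
      * (Y6 * ellFac (a * q ^ 3 / e) q p i) * (Y3 * ellFac (a * q ^ (n + 3)) q p i))
    X0 n0 hQ n1 nE3 n3 nE n2 key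
  convert h using 1
  · congr 1
    · ring
    · ring
  · ring

theorem ftProduct_succ (a b c d q p : ℂ) (n : ℕ) :
    ftProduct a b c d q p (n + 1) = ftProduct a b c d q p n
      * ((ellTheta (a * q ^ (n + 1)) p * ellTheta (a * q ^ (n + 1) / (b * c)) p
          * (ellTheta (a * q ^ (n + 1) / (b * d)) p * ellTheta (a * q ^ (n + 1) / (c * d)) p))
        / (ellTheta (a * q ^ (n + 1) / b) p * ellTheta (a * q ^ (n + 1) / c) p
          * (ellTheta (a * q ^ (n + 1) / d) p * ellTheta (a * q ^ (n + 1) / (b * c * d)) p))) := by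
  have h : ∀ x, a * q / x * q ^ n = a * q ^ (n + 1) / x := fun x => by ring
  have h' : a * q * q ^ n = a * q ^ (n + 1) := by ring
  simp only [ftProduct, ellFac_succ, h, h']
  ring

/-- The rational identity behind `ftProduct_contiguous`. -/
theorem ftProduct_rational_identity {r s t u v w x y z k l m N D E A B C : ℂ}
    (hr : r ≠ 0) (hs : s ≠ 0) (ht : t ≠ 0) (hu : u ≠ 0) (hv : v ≠ 0)
    (hw : w ≠ 0) (hx : x ≠ 0) (hy : y ≠ 0) (hz : z ≠ 0)
    (hk : k ≠ 0) :
    r * s * N * t * m * k / (u * v * w * (l * z) * x * y)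
      * ((D * (x * y) / (r * s) * E) / (A / u * (B / v) * (C / w) * (t / (-z / k))))
      = E * D / (A * B * C) * (-(N * m) / l) := by
  field_simp

theorem ellTheta_inv_ne_zero {x p : ℂ} (hx : x ≠ 0) (hp : ‖p‖ < 1) (h : ellTheta x p ≠ 0) :
    ellTheta (1 / x) p ≠ 0 := by
  rw [ellTheta_inv hx hp]
  exact div_ne_zero (neg_ne_zero.2 h) hx

/-- The recurrence satisfied by the right-hand side of the Frenkel–Turaev sum, matching
`vwpTerm_contiguous`. -/
theorem ftProduct_contiguous {a b c d e q p : ℂ} {n : ℕ} (hp : ‖p‖ < 1) (hq : q ≠ 0)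
    (ha : a ≠ 0) (hb : b ≠ 0) (hc : c ≠ 0) (hd : d ≠ 0)
    (he : b * c * d * e = a ^ 2 * q ^ (n + 2))
    (hA : ∀ i : ℕ, ellTheta (a * q ^ i) p ≠ 0)
    (hB : ∀ j < n + 1, ellTheta (a * q ^ (j + 1) / b) p ≠ 0)
    (hC : ∀ j < n + 1, ellTheta (a * q ^ (j + 1) / c) p ≠ 0)
    (hD : ∀ j < n + 1, ellTheta (a * q ^ (j + 1) / d) p ≠ 0)
    (hE : ∀ j : ℕ, ellTheta (a * q ^ (j + 1) / e) p ≠ 0) :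
    ftProduct a b c d q p (n + 1) - ftProduct a b c d q p n
    = (ellTheta (a * q) p * ellTheta (a * q ^ 2) p * ellTheta b p * ellTheta c p * ellTheta d p
        * ellTheta (e / (a * q ^ (n + 2))) p * ellTheta (e * q ^ n) p * (a * q ^ 2 / e))
      / (ellTheta (a * q / b) p * ellTheta (a * q / c) p * ellTheta (a * q / d) p
        * ellTheta (a * q / e) p * ellTheta (a * q ^ 2 / e) p * ellTheta (a * q ^ (n + 1)) p
        * ellTheta (a * q ^ (n + 2)) p)
      * ftProduct (a * q ^ 2) (b * q) (c * q) (d * q) q p n := by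
  have he0 : e ≠ 0 := by
    rintro rfl
    rw [mul_zero] at he
    exact mul_ne_zero (pow_ne_zero 2 ha) (pow_ne_zero (n + 2) hq) he.symm
  have hbcd : b * c * d = a ^ 2 * q ^ (n + 2) / e := eq_div_of_mul_eq he0 he
  have key := ellTheta_add (p := p) (A := a * q ^ (n + 1)) hp (mul_ne_zero ha (pow_ne_zero _ hq))
    hb hc hd
  have e1 : a * q ^ (n + 1) / (b * c * d) = 1 / (a * q / e) := by
    rw [hbcd]
    field_simp
    ring
  have e2 : (a * q ^ (n + 1)) ^ 2 / (b * c * d) = e * q ^ n := by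
    rw [hbcd]
    field_simp
    ring
  have e3 : a * q ^ 2 * q / (b * q * (c * q) * (d * q)) = e / (a * q ^ (n + 2)) := by
    rw [show b * q * (c * q) * (d * q) = (b * c * d) * q ^ 3 by ring, hbcd]
    field_simp
  have e4 : a * q / (b * c * d) = e / (a * q ^ (n + 2)) * q := by
    rw [hbcd]
    field_simp
  have hx1 : a * q / e ≠ 0 := div_ne_zero (mul_ne_zero ha hq) he0
  have hx2 : a * q ^ 2 / e ≠ 0 := div_ne_zero (mul_ne_zero ha (pow_ne_zero 2 hq)) he0
  have nz : ∀ x : ℂ, (∀ j < n + 1, ellTheta (a * q ^ (j + 1) / x) p ≠ 0) →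
      ellTheta (a * q / x) p ≠ 0 ∧ ellTheta (a * q ^ (n + 1) / x) p ≠ 0 ∧
      ellFac (a * q ^ 2 / x) q p n
        = ellFac (a * q / x) q p n * ellTheta (a * q ^ (n + 1) / x) p / ellTheta (a * q / x) p := by
    intro x hx
    have h : ellTheta (a * q / x) p ≠ 0 := by simpa using hx 0 (by omega)
    refine ⟨h, hx n (by omega), eq_div_of_mul_eq h ?_⟩
    rw [show a * q ^ (n + 1) / x = a * q / x * q ^ n by ring, ← ellFac_succ, ellFac_succ',
      show a * q / x * q = a * q ^ 2 / x by ring, mul_comm]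
  obtain ⟨nB, nB', sB⟩ := nz b hB
  obtain ⟨nC, nC', sC⟩ := nz c hC
  obtain ⟨nD, nD', sD⟩ := nz d hD
  have nE : ellTheta (a * q / e) p ≠ 0 := by simpa using hE 0
  have nE2 : ellTheta (a * q ^ 2 / e) p ≠ 0 := hE 1
  have nE3 : ellTheta (e / (a * q ^ (n + 2))) p ≠ 0 := by
    have := ellTheta_inv_ne_zero (div_ne_zero (mul_ne_zero ha (pow_ne_zero (n + 2) hq)) he0) hp
      (hE (n + 1))
    rwa [one_div_div] at this
  have n1 : ellTheta (a * q) p ≠ 0 := by simpa using hA 1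
  have n2 := hA 2
  have n3 := hA (n + 1)
  have n4 := hA (n + 2)
  have hA' : ellFac (a * q ^ 3) q p n = ellFac (a * q) q p n
      * (ellTheta (a * q ^ (n + 1)) p * ellTheta (a * q ^ (n + 2)) p)
      / (ellTheta (a * q) p * ellTheta (a * q ^ 2) p) := by
    refine eq_div_of_mul_eq (mul_ne_zero n1 n2) ?_
    rw [show a * q ^ (n + 1) = a * q * q ^ n by ring,
      show a * q ^ (n + 2) = a * q * q ^ (n + 1) by ring, ← mul_assoc (ellFac (a * q) q p n),
      ← ellFac_succ, ← ellFac_succ, ellFac_succ', ellFac_succ']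
    ring_nf
  have hE' : ellFac (e / (a * q ^ (n + 2))) q p n = ellTheta (e / (a * q ^ (n + 2))) p
      / (-(ellTheta (a * q ^ 2 / e) p) / (a * q ^ 2 / e))
      * ellFac (a * q / (b * c * d)) q p n := by
    rw [← ellTheta_inv hx2 hp, one_div_div, e4, div_mul_eq_mul_div, ← ellFac_succ']
    refine eq_div_of_mul_eq ?_ ?_
    · rw [← one_div_div]
      exact ellTheta_inv_ne_zero hx2 hp nE2
    rw [ellFac_succ]
    congr 2
    field_simp
    ring
  -- By `ftProduct_succ` the left-hand side is `ftProduct a b c d q p n` times a quotient minus `1`,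
  -- which the addition formula turns into a single product.
  rw [ftProduct_succ, e1]
  rw [e1, e2] at key
  have nE1 := ellTheta_inv_ne_zero hx1 hp nE
  have h1 : ellTheta (a * q ^ (n + 1)) p * ellTheta (a * q ^ (n + 1) / (b * c)) p
          * (ellTheta (a * q ^ (n + 1) / (b * d)) p * ellTheta (a * q ^ (n + 1) / (c * d)) p)
        / (ellTheta (a * q ^ (n + 1) / b) p * ellTheta (a * q ^ (n + 1) / c) p
          * (ellTheta (a * q ^ (n + 1) / d) p * ellTheta (1 / (a * q / e)) p)) - 1
      = 1 / (a * q / e) * (ellTheta b p * ellTheta c p * (ellTheta d p * ellTheta (e * q ^ n) p))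
        / (ellTheta (a * q ^ (n + 1) / b) p * ellTheta (a * q ^ (n + 1) / c) p
          * (ellTheta (a * q ^ (n + 1) / d) p * ellTheta (1 / (a * q / e)) p)) := by
    rw [← key, sub_div, div_self]
    exact mul_ne_zero (mul_ne_zero nB' nC') (mul_ne_zero nD' nE1)
  have h2 := ftProduct_rational_identity
    (m := ellTheta (e * q ^ n) p) (N := ellTheta b p * ellTheta c p * ellTheta d p)
    (D := ellFac (a * q) q p n)
    (E := ellFac (a * q / (b * c)) q p n * ellFac (a * q / (b * d)) q p n
      * ellFac (a * q / (c * d)) q p n / ellFac (a * q / (b * c * d)) q p n)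
    (A := ellFac (a * q / b) q p n * ellTheta (a * q ^ (n + 1) / b) p)
    (B := ellFac (a * q / c) q p n * ellTheta (a * q ^ (n + 1) / c) p)
    (C := ellFac (a * q / d) q p n * ellTheta (a * q ^ (n + 1) / d) p)
    (l := ellTheta (a * q / e) p)
    n1 n2 nE3 nB nC nD n3 n4 nE2 hx2
  trans ftProduct a b c d q p n * (ellTheta (a * q ^ (n + 1)) p
      * ellTheta (a * q ^ (n + 1) / (b * c)) p
          * (ellTheta (a * q ^ (n + 1) / (b * d)) p * ellTheta (a * q ^ (n + 1) / (c * d)) p)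
        / (ellTheta (a * q ^ (n + 1) / b) p * ellTheta (a * q ^ (n + 1) / c) p
          * (ellTheta (a * q ^ (n + 1) / d) p * ellTheta (1 / (a * q / e)) p)) - 1)
  · ring
  rw [h1]
  have h3 : ellTheta (1 / (a * q / e)) p = -(ellTheta (a * q / e) p) / (a * q / e) :=
    ellTheta_inv hx1 hp
  have h4 : ∀ u v : ℂ, 1 / (a * q / e) * u / (v * (-(ellTheta (a * q / e) p) / (a * q / e)))
      = -u / ellTheta (a * q / e) p / v := by
    intro u v
    rcases eq_or_ne v 0 with rfl | hv
    · simp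
    field_simp
  rw [h3, ← mul_assoc (_ * _) (ellTheta _ _) (_ / _), h4]
  have h5 : ∀ x, a * q ^ 2 * q / (x * q) = a * q ^ 2 / x := fun x => mul_div_mul_right _ _ hq
  have h6 : ∀ x y, a * q ^ 2 * q / (x * q * (y * q)) = a * q / (x * y) := fun x y => by field_simp
  simp only [ftProduct, h5, h6, e3, sB, sC, sD, hE']
  rw [show a * q ^ 2 * q = a * q ^ 3 by ring, hA']
  linear_combination -h2

/-- The Frenkel–Turaev sum: a product formula for the terminating, balanced, very-well-poised
elliptic hypergeometric series `₁₀V₉`. The proof is by induction on `n`, for all parameters at once: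
the sum for `n + 1` is the sum for `n` with `e` replaced by `e/q`, plus a multiple of the sum for
`n` with `a, b, c, d` replaced by `aq², bq, cq, dq`. -/
theorem sum_vwpTerm {q p : ℂ} (hp : ‖p‖ < 1) (hq : q ≠ 0) (n : ℕ) : ∀ {a b c d e : ℂ},
    a ≠ 0 → b ≠ 0 → c ≠ 0 → d ≠ 0 → b * c * d * e = a ^ 2 * q ^ (n + 1) →
    (∀ i : ℕ, ellTheta (a * q ^ i) p ≠ 0) →
    (∀ j < n, ellTheta (q ^ (j + 1)) p ≠ 0) →
    (∀ j < n, ellTheta (a * q ^ (j + 1) / b) p ≠ 0) →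
    (∀ j < n, ellTheta (a * q ^ (j + 1) / c) p ≠ 0) →
    (∀ j < n, ellTheta (a * q ^ (j + 1) / d) p ≠ 0) →
    (∀ j : ℕ, ellTheta (a * q ^ j / e) p ≠ 0) →
    ∑ k ∈ Finset.range (n + 1), vwpTerm a b c d e (1 / q ^ n) q p k
      = ftProduct a b c d q p n := by
  induction n with
  | zero =>
    intro a b c d e _ _ _ _ _ hA _ _ _ _ _
    have h0 : ellTheta a p ≠ 0 := by simpa using hA 0
    simp [vwpTerm_zero h0, ftProduct, ellFac_zero]
  | succ n ih =>
    intro a b c d e ha hb hc hd he hA hQ hB hC hD hE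
    have h0 : ellTheta a p ≠ 0 := by simpa using hA 0
    have he0 : e ≠ 0 := by
      rintro rfl
      rw [mul_zero] at he
      exact mul_ne_zero (pow_ne_zero 2 ha) (pow_ne_zero _ hq) he.symm
    have hE' : ∀ j : ℕ, ellTheta (a * q ^ (j + 1) / e) p ≠ 0 := fun j => hE (j + 1)
    have hP := ftProduct_contiguous hp hq ha hb hc hd he hA hB hC hD hE'
    have ih1 := ih (a := a) (b := b) (c := c) (d := d) (e := e / q) ha hb hc hd
      (by rw [mul_div_assoc', he]; field_simp; ring) hA (fun j hj => hQ j (by omega))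
      (fun j hj => hB j (by omega)) (fun j hj => hC j (by omega)) (fun j hj => hD j (by omega))
      (fun j => by
        rw [show a * q ^ j / (e / q) = a * q ^ (j + 1) / e by field_simp; ring]
        exact hE' j)
    have hsh : ∀ (x : ℂ) (j : ℕ), a * q ^ 2 * q ^ (j + 1) / (x * q) = a * q ^ (j + 1 + 1) / x :=
      fun x j => by field_simp; ring
    have ih2 := ih (a := a * q ^ 2) (b := b * q) (c := c * q) (d := d * q) (e := e)
      (mul_ne_zero ha (pow_ne_zero _ hq)) (mul_ne_zero hb hq) (mul_ne_zero hc hq)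
      (mul_ne_zero hd hq) (by linear_combination q ^ 3 * he)
      (fun i => by rw [mul_assoc, ← pow_add]; exact hA _) (fun j hj => hQ j (by omega))
      (fun j hj => by rw [hsh]; exact hB _ (by omega))
      (fun j hj => by rw [hsh]; exact hC _ (by omega))
      (fun j hj => by rw [hsh]; exact hD _ (by omega))
      (fun j => by rw [mul_assoc a, ← pow_add]; exact hE _)
    -- The series for `n` may be summed up to `n + 1`, as it terminates.
    have hlast : vwpTerm a b c d (e / q) (1 / q ^ n) q p (n + 1) = 0 := by
      rw [vwpTerm, ellFac_one_div_pow_eq_zero hq p (Nat.lt_succ_self n)]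
      simp
    rw [← ih1, ← ih2, ← add_zero (∑ k ∈ Finset.range (n + 1), vwpTerm a b c d (e / q) _ q p k),
      ← hlast, ← Finset.sum_range_succ, Finset.mul_sum] at hP
    refine Eq.trans ?_ (sub_eq_iff_eq_add.1 hP).symm
    rw [← sub_eq_iff_eq_add, ← Finset.sum_sub_distrib, Finset.sum_range_succ', vwpTerm_zero h0,
      vwpTerm_zero h0, sub_self, add_zero]
    refine Finset.sum_congr rfl fun i hi => ?_
    exact vwpTerm_contiguous hp hq ha he0 hA (hQ i (Finset.mem_range.1 hi)) hE'

/-- An indefinite sum: the case of the very-well-poised series in which it telescopes. -/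
theorem sum_telescoping {a b c q p : ℂ} {N : ℕ} (hp : ‖p‖ < 1) (hq : q ≠ 0)
    (ha : a ≠ 0) (hb : b ≠ 0) (hc : c ≠ 0) (hA : ellTheta a p ≠ 0)
    (hQ : ∀ j < N, ellTheta (q ^ (j + 1)) p ≠ 0)
    (hB : ∀ j < N, ellTheta (a * q ^ (j + 1) / b) p ≠ 0)
    (hC : ∀ j < N, ellTheta (a * q ^ (j + 1) / c) p ≠ 0)
    (hD : ∀ j < N, ellTheta (b * c * q ^ (j + 1)) p ≠ 0) :
    ∑ k ∈ Finset.range (N + 1), ellTheta (a * q ^ (2 * k)) p / ellTheta a p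
        * ((ellFac a q p k * ellFac b q p k * ellFac c q p k * ellFac (a / (b * c)) q p k)
          / (ellFac q q p k * ellFac (a * q / b) q p k * ellFac (a * q / c) q p k
            * ellFac (b * c * q) q p k)) * q ^ k
      = (ellFac (a * q) q p N * ellFac (b * q) q p N * ellFac (c * q) q p N
          * ellFac (a * q / (b * c)) q p N)
        / (ellFac q q p N * ellFac (a * q / b) q p N * ellFac (a * q / c) q p N
          * ellFac (b * c * q) q p N) := by
  induction N with
  | zero => simp [ellFac_zero, hA]
  | succ N ih =>
    rw [Finset.sum_range_succ, ih (fun j hj => hQ j (by omega)) (fun j hj => hB j (by omega))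
      (fun j hj => hC j (by omega)) (fun j hj => hD j (by omega))]
    have key := ellTheta_add (p := p) (A := a * q ^ (N + 1)) (b := b) (c := c) (d := a / (b * c))
      hp (mul_ne_zero ha (pow_ne_zero _ hq)) hb hc (div_ne_zero ha (mul_ne_zero hb hc))
    rw [show a * q ^ (N + 1) / (b * (a / (b * c))) = c * q * q ^ N by field_simp; ring,
      show a * q ^ (N + 1) / (c * (a / (b * c))) = b * q * q ^ N by field_simp; ring,
      show a * q ^ (N + 1) / (b * c) = a * q / (b * c) * q ^ N by ring,
      show a * q ^ (N + 1) / b = a * q / b * q ^ N by ring,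
      show a * q ^ (N + 1) / c = a * q / c * q ^ N by ring,
      show a * q ^ (N + 1) / (a / (b * c)) = b * c * q * q ^ N by field_simp; ring,
      show a * q ^ (N + 1) / (b * c * (a / (b * c))) = q * q ^ N by field_simp; ring,
      show (a * q ^ (N + 1)) ^ 2 / (b * c * (a / (b * c))) = a * q ^ (2 * (N + 1)) by
        field_simp; ring,
      show a * q ^ (N + 1) = a * q * q ^ N by ring] at key
    have h1 : ellTheta (q * q ^ N) p ≠ 0 := by
      rw [← pow_succ']
      exact hQ N (by omega)
    have h2 : ellTheta (a * q / b * q ^ N) p ≠ 0 := by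
      rw [show a * q / b * q ^ N = a * q ^ (N + 1) / b by ring]
      exact hB N (by omega)
    have h3 : ellTheta (a * q / c * q ^ N) p ≠ 0 := by
      rw [show a * q / c * q ^ N = a * q ^ (N + 1) / c by ring]
      exact hC N (by omega)
    have h4 : ellTheta (b * c * q * q ^ N) p ≠ 0 := by
      rw [show b * c * q * q ^ N = b * c * q ^ (N + 1) by ring]
      exact hD N (by omega)
    rw [ellFac_succ' a, ellFac_succ' b, ellFac_succ' c, ellFac_succ' (a / (b * c)),
      show a / (b * c) * q = a * q / (b * c) by ring]
    simp only [ellFac_succ]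
    generalize ellTheta (q * q ^ N) p = x1 at *
    generalize ellTheta (a * q / b * q ^ N) p = x2 at *
    generalize ellTheta (a * q / c * q ^ N) p = x3 at *
    generalize ellTheta (b * c * q * q ^ N) p = x4 at *
    trans (ellFac (a * q) q p N * ellFac (b * q) q p N * ellFac (c * q) q p N
          * ellFac (a * q / (b * c)) q p N)
        / (ellFac q q p N * ellFac (a * q / b) q p N * ellFac (a * q / c) q p N
          * ellFac (b * c * q) q p N) * ((x2 * x3 * (x4 * x1)
            + q * q ^ N * (ellTheta b p * ellTheta c p * (ellTheta (a / (b * c)) p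
              * ellTheta (a * q ^ (2 * (N + 1))) p))) / (x2 * x3 * (x4 * x1)))
    · rw [add_div, div_self (by positivity), mul_add (_ / _), mul_one, add_right_inj]
      linear_combination (ellFac (a * q) q p N * ellFac (b * q) q p N * ellFac (c * q) q p N
          * ellFac (a * q / (b * c)) q p N)
        / (ellFac q q p N * ellFac (a * q / b) q p N * ellFac (a * q / c) q p N
          * ellFac (b * c * q) q p N) * (q * q ^ N * (ellTheta b p * ellTheta c p
          * (ellTheta (a / (b * c)) p * ellTheta (a * q ^ (2 * (N + 1))) p))
            / (x2 * x3 * (x4 * x1))) * mul_inv_cancel₀ hA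
    · rw [← key]
      ring

/-! ### A quadratic summation -/

theorem ellFac_mul_shift (x q p : ℂ) (k : ℕ) :
    ellFac (x * q) q p k * ellTheta x p = ellFac x q p k * ellTheta (x * q ^ k) p := by
  rw [← ellFac_succ, ellFac_succ', mul_comm]

theorem ellTheta_sq_nome_ne_zero {x p : ℂ} (hp : ‖p‖ < 1) (h : ellTheta x p ≠ 0) :
    ellTheta x (p ^ 2) ≠ 0 := by
  have hp2 := norm_sq_lt_one hp
  contrapose! h
  rw [ellTheta_eq_zero_iff _ hp2] at h
  rw [ellTheta_eq_zero_iff _ hp]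
  rcases h with ⟨j, hj⟩ | ⟨j, hj⟩
  · exact Or.inl ⟨2 * j, by rw [pow_mul, hj]⟩
  · exact Or.inr ⟨2 * j + 1, by rw [← hj]; ring⟩

/-- The quotient `θ(cq^k) θ(aq^k/c) / (θ(c) θ(a/c))`. The `k`-th term of a well-poised series is
multiplied by it when the parameter `c` is replaced by `cq` and, accordingly, the denominator
parameter `aq/c` by `a/c`. -/
noncomputable def thetaWeight (a c q p : ℂ) (k : ℕ) : ℂ :=
  ellTheta (c * q ^ k) p * ellTheta (a / c * q ^ k) p / (ellTheta c p * ellTheta (a / c) p)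

/-- Partial fractions for the quadratic factor `q^k θ(-aq^{2k}) / θ(-a)` in terms of products
of two weights; this turns a quadratic summation into a combination of Frenkel–Turaev sums. -/
theorem pow_mul_ellTheta_neg {a r q p : ℂ} (hp : ‖p‖ < 1) (hq : q ≠ 0) (ha : a ≠ 0) (hr : r ≠ 0)
    (h1 : ellTheta (-a) p ≠ 0) (h2 : ellTheta r p ≠ 0) (h3 : ellTheta (-r) p ≠ 0)
    (h4 : ellTheta (a / r) p ≠ 0) (h5 : ellTheta (-(a / r)) p ≠ 0) (k : ℕ) :
    q ^ k * (ellTheta (-(a * q ^ (2 * k))) p / ellTheta (-a) p)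
      = thetaWeight a (-a) q p k * thetaWeight a r q p k
        + thetaWeight a (-a) q p k * thetaWeight a (-r) q p k
        - thetaWeight a r q p k * thetaWeight a (-r) q p k := by
  have h6 := ellTheta_neg_one_ne_zero hp
  have key := ellTheta_duplication hp hr (div_ne_zero ha hr) (pow_ne_zero k hq)
  rw [show r * (a / r) = a by field_simp, ← pow_mul, mul_comm k 2] at key
  have e1 : a / -a = -1 := by rw [div_neg, div_self ha]
  have e2 : a / -r = -(a / r) := div_neg a
  simp only [thetaWeight, e1, e2, neg_mul, one_mul]
  generalize ellTheta (-(a * q ^ (2 * k))) p = t1 at *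
  generalize ellTheta (-1) p = t2 at *
  generalize ellTheta r p = t3 at *
  generalize ellTheta (-r) p = t4 at *
  generalize ellTheta (a / r) p = t5 at *
  generalize ellTheta (-(a / r)) p = t6 at *
  generalize ellTheta (-a) p = t7 at *
  generalize ellTheta (r * q ^ k) p = t8 at *
  generalize ellTheta (-(r * q ^ k)) p = t9 at *
  generalize ellTheta (a / r * q ^ k) p = s1 at *
  generalize ellTheta (-(a / r * q ^ k)) p = s2 at *
  generalize ellTheta (-(a * q ^ k)) p = s3 at *
  generalize ellTheta (-q ^ k) p = s4 at *
  field_simp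
  linear_combination key

/-- Multiplying the terms of a very-well-poised series by two weights shifts two parameters. -/
theorem vwpTerm_shift {a b c d e f q p : ℂ} (k : ℕ) (hq : q ≠ 0) (hc0 : c ≠ 0) (hd0 : d ≠ 0)
    (hc : ellTheta c p ≠ 0) (hc' : ellTheta (a / c) p ≠ 0)
    (hd : ellTheta d p ≠ 0) (hd' : ellTheta (a / d) p ≠ 0)
    (hc'' : ellTheta (a / c * q ^ k) p ≠ 0) (hd'' : ellTheta (a / d * q ^ k) p ≠ 0) :
    vwpTerm a b (c * q) (d * q) e f q p k
      = vwpTerm a b c d e f q p k * (thetaWeight a c q p k * thetaWeight a d q p k) := by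
  have h1 : ∀ x, ellTheta x p ≠ 0 → ellFac (x * q) q p k
      = ellFac x q p k * (ellTheta (x * q ^ k) p / ellTheta x p) := by
    intro x hx
    rw [← mul_div_assoc]
    exact eq_div_of_mul_eq hx (ellFac_mul_shift x q p k)
  have h2 : ∀ x, a * q / x = a / x * q := fun x => by ring
  have h3 : ∀ x, x ≠ 0 → a * q / (x * q) = a / x := fun x hx => by field_simp
  unfold vwpTerm thetaWeight
  rw [h3 c hc0, h3 d hd0, h2 c, h2 d, h1 c hc, h1 d hd, h1 _ hc', h1 _ hd']
  have h4 : 1 = ellTheta (a / c) p * (ellTheta (a / c) p)⁻¹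
      * (ellTheta (a / d) p * (ellTheta (a / d) p)⁻¹)
      * (ellTheta (a / c * q ^ k) p * (ellTheta (a / c * q ^ k) p)⁻¹)
      * (ellTheta (a / d * q ^ k) p * (ellTheta (a / d * q ^ k) p)⁻¹) := by
    rw [mul_inv_cancel₀ hc', mul_inv_cancel₀ hd', mul_inv_cancel₀ hc'', mul_inv_cancel₀ hd'']
    ring
  refine (mul_one _).symm.trans ?_
  rw [h4]
  simp only [div_eq_mul_inv, mul_inv, inv_inv]
  ring

theorem vwpTerm_swap (a b c d e f q p : ℂ) (k : ℕ) :
    vwpTerm a b c d e f q p k = vwpTerm a c b d e f q p k := by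
  unfold vwpTerm
  ring

theorem vwpTerm_swap' (a b c d e f q p : ℂ) (k : ℕ) :
    vwpTerm a b c d e f q p k = vwpTerm a b d c e f q p k := by
  unfold vwpTerm
  ring

/-- A very-well-poised term with the quadratic factor is a combination of three very-well-poised
terms without it, all of which are balanced if `r² = a/(bq)` and `e = bq^n`, `f = q^{-n}`. -/
theorem pow_mul_vwpTerm {a r e f q p : ℂ} (k : ℕ) (hp : ‖p‖ < 1) (hq : q ≠ 0) (ha : a ≠ 0)
    (hr : r ≠ 0) (h1 : ellTheta (-a) p ≠ 0) (h2 : ellTheta r p ≠ 0) (h3 : ellTheta (-r) p ≠ 0)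
    (h4 : ∀ j : ℕ, ellTheta (a / r * q ^ j) p ≠ 0)
    (h5 : ∀ j : ℕ, ellTheta (-(a / r) * q ^ j) p ≠ 0) (h6 : ellTheta (-q ^ k) p ≠ 0) :
    vwpTerm a (-a) r (-r) e f q p k
        * (q ^ k * (ellTheta (-(a * q ^ (2 * k))) p / ellTheta (-a) p))
      = vwpTerm a (-(a * q)) (r * q) (-r) e f q p k
        + vwpTerm a (-(a * q)) (-(r * q)) r e f q p k
        - vwpTerm a (-a) (r * q) (-(r * q)) e f q p k := by
  have n1 := ellTheta_neg_one_ne_zero hp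
  have e1 : a / -a = -1 := by rw [div_neg, div_self ha]
  have e2 : a / -r = -(a / r) := div_neg a
  have h40 : ellTheta (a / r) p ≠ 0 := by simpa using h4 0
  have h50 : ellTheta (-(a / r)) p ≠ 0 := by simpa using h5 0
  have h6' : ellTheta (a / -a * q ^ k) p ≠ 0 := by rwa [e1, neg_one_mul]
  rw [pow_mul_ellTheta_neg hp hq ha hr h1 h2 h3 h40 h50]
  have v1 := vwpTerm_shift (a := a) (b := -r) (c := -a) (d := r) (e := e) (f := f) k hq
    (neg_ne_zero.2 ha) hr h1 (by rwa [e1]) h2 h40 h6' (h4 k)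
  have v2 := vwpTerm_shift (a := a) (b := r) (c := -a) (d := -r) (e := e) (f := f) k hq
    (neg_ne_zero.2 ha) (neg_ne_zero.2 hr) h1 (by rwa [e1]) h3 (by rwa [e2]) h6'
    (by rw [e2]; exact h5 k)
  have v3 := vwpTerm_shift (a := a) (b := -a) (c := r) (d := -r) (e := e) (f := f) k hq
    hr (neg_ne_zero.2 hr) h2 h40 h3 (by rwa [e2]) (h4 k) (by rw [e2]; exact h5 k)
  rw [vwpTerm_swap, vwpTerm_swap', vwpTerm_swap a (-r) (-a), vwpTerm_swap' a (-a) (-r)] at v1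
  rw [vwpTerm_swap, vwpTerm_swap', vwpTerm_swap a r (-a)] at v2
  simp only [neg_mul] at v1 v2 v3
  rw [v1, v2, v3]
  ring

/-- Summation of a very-well-poised series with the additional factor `q^k θ(-aq^{2k}) / θ(-a)`,
where `a = bqr²`. The parameters `±r` are the square roots of `a / (bq)`. -/
theorem sum_vwpTerm_quadratic {a b r q p : ℂ} {n : ℕ} (hp : ‖p‖ < 1) (hq : q ≠ 0) (hb : b ≠ 0)
    (hr : r ≠ 0) (har : a = b * q * r ^ 2)
    (hA : ∀ j : ℕ, ellTheta (a * q ^ j) p ≠ 0) (hA' : ellTheta (-a) p ≠ 0)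
    (hQ : ∀ j < n, ellTheta (q ^ (j + 1)) p ≠ 0) (hQ' : ∀ j < n, ellTheta (-q ^ (j + 1)) p ≠ 0)
    (hb1 : ellTheta (-b) p ≠ 0) (hr1 : ellTheta r p ≠ 0) (hr2 : ellTheta (-r) p ≠ 0)
    (hr3 : ellTheta (1 / (r * q)) p ≠ 0) (hr4 : ellTheta (-(1 / (r * q))) p ≠ 0)
    (hC : ∀ j : ℕ, ellTheta (a / r * q ^ j) p ≠ 0)
    (hD : ∀ j : ℕ, ellTheta (-(a / r) * q ^ j) p ≠ 0)
    (hE : ∀ j : ℕ, ellTheta (a * q ^ j / (b * q ^ n)) p ≠ 0) :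
    ∑ k ∈ Finset.range (n + 1), vwpTerm a (-a) r (-r) (b * q ^ n) (1 / q ^ n) q p k
        * (q ^ k * (ellTheta (-(a * q ^ (2 * k))) p / ellTheta (-a) p))
      = q ^ n * ellTheta (-(b * q ^ (2 * n))) p * ellFac (-b) q p n * ellFac (a * q) q p n
          * (ellFac (1 / (r * q)) q p n * ellFac (-(1 / (r * q))) q p n)
        / (ellTheta (-b) p * ellFac (-q) q p n * ellFac (b / a) q p n
          * (ellFac (a / r * q) q p n * ellFac (-(a / r) * q) q p n)) := by
  have ha : a ≠ 0 := by
    rw [har]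
    positivity
  have n1 := ellTheta_neg_one_ne_zero hp
  have hQ0 : ∀ j ≤ n, ellTheta (-q ^ j) p ≠ 0 := by
    intro j hj
    rcases j with _ | j
    · simpa using n1
    · exact hQ' j hj
  rw [Finset.sum_congr rfl fun k hk => pow_mul_vwpTerm k hp hq ha hr hA' hr1 hr2 hC hD
    (hQ0 k (Nat.lt_succ_iff.1 (Finset.mem_range.1 hk))), Finset.sum_sub_distrib,
    Finset.sum_add_distrib]
  have hC' : ∀ j : ℕ, ellTheta (a * q ^ j / r) p ≠ 0 := fun j => by
    rw [show a * q ^ j / r = a / r * q ^ j by ring]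
    exact hC j
  have hD' : ∀ j : ℕ, ellTheta (a * q ^ j / -r) p ≠ 0 := fun j => by
    rw [show a * q ^ j / -r = -(a / r) * q ^ j by rw [div_neg]; ring]
    exact hD j
  have hQ2 : ∀ j < n, ellTheta (a * q ^ (j + 1) / (-(a * q))) p ≠ 0 := fun j hj => by
    rw [show a * q ^ (j + 1) / (-(a * q)) = -q ^ j by field_simp; ring]
    exact hQ0 j hj.le
  have hCq : ∀ j < n, ellTheta (a * q ^ (j + 1) / (r * q)) p ≠ 0 := fun j _ => by
    rw [show a * q ^ (j + 1) / (r * q) = a * q ^ j / r by field_simp; ring]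
    exact hC' j
  have hDq : ∀ j < n, ellTheta (a * q ^ (j + 1) / (-(r * q))) p ≠ 0 := fun j _ => by
    rw [show a * q ^ (j + 1) / (-(r * q)) = a * q ^ j / -r by field_simp; ring]
    exact hD' j
  have f1 := sum_vwpTerm (a := a) (b := -(a * q)) (c := r * q) (d := -r) (e := b * q ^ n) hp hq n
    ha (neg_ne_zero.2 (mul_ne_zero ha hq)) (mul_ne_zero hr hq) (neg_ne_zero.2 hr)
    (by rw [har]; ring) hA hQ hQ2 hCq (fun j _ => hD' _) hE
  have f2 := sum_vwpTerm (a := a) (b := -(a * q)) (c := -(r * q)) (d := r) (e := b * q ^ n) hp hq n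
    ha (neg_ne_zero.2 (mul_ne_zero ha hq)) (neg_ne_zero.2 (mul_ne_zero hr hq)) hr
    (by rw [har]; ring) hA hQ hQ2 hDq (fun j _ => hC' _) hE
  have f3 := sum_vwpTerm (a := a) (b := -a) (c := r * q) (d := -(r * q)) (e := b * q ^ n) hp hq n
    ha (neg_ne_zero.2 ha) (mul_ne_zero hr hq) (neg_ne_zero.2 (mul_ne_zero hr hq))
    (by rw [har]; ring) hA hQ (fun j hj => by
      rw [show a * q ^ (j + 1) / -a = -q ^ (j + 1) by field_simp]
      exact hQ' j hj) hCq hDq hE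
  rw [f1, f2, f3]
  -- The three values combine by the same theta identity that was used to split the sum.
  have key := ellTheta_duplication hp (x := 1 / (r * q)) (y := a / r) (z := q ^ n)
    (one_div_ne_zero (mul_ne_zero hr hq)) (div_ne_zero ha hr) (pow_ne_zero n hq)
  have hxy : 1 / (r * q) * (a / r) = b := by
    rw [har]
    field_simp
  have hrq : 1 / r = 1 / (r * q) * q := by field_simp
  have hrq' : -(1 / r) = -(1 / (r * q)) * q := by field_simp
  rw [hxy, ← pow_mul, mul_comm n 2] at key
  have sh : ∀ x, ellTheta x p ≠ 0 → ellFac (x * q) q p n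
      = ellFac x q p n * (ellTheta (x * q ^ n) p / ellTheta x p) := by
    intro x hx
    rw [← mul_div_assoc]
    exact eq_div_of_mul_eq hx (ellFac_mul_shift x q p n)
  have hC0 : ellTheta (a / r) p ≠ 0 := by simpa using hC 0
  have hD0 : ellTheta (-(a / r)) p ≠ 0 := by simpa using hD 0
  simp only [ftProduct]
  rw [show a * q / (-(a * q) * (r * q)) = -(1 / (r * q)) by field_simp,
    show a * q / (-(a * q) * -r) = 1 / r by field_simp,
    show a * q / (r * q * -r) = -b * q by rw [har]; field_simp,
    show a * q / -(a * q) = -1 by field_simp,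
    show a * q / (r * q) = a / r by field_simp,
    show a * q / -r = -(a / r) * q by rw [div_neg]; ring,
    show a * q / (-(a * q) * (r * q) * -r) = b / a by rw [har]; field_simp,
    show a * q / (-(a * q) * -(r * q)) = 1 / (r * q) by field_simp,
    show a * q / (-(a * q) * r) = -(1 / r) by field_simp,
    show a * q / (-(r * q) * r) = -b * q by rw [har]; field_simp,
    show a * q / -(r * q) = -(a / r) by field_simp,
    show a * q / r = a / r * q by ring,
    show a * q / (-(a * q) * -(r * q) * r) = b / a by rw [har]; field_simp,
    show a * q / (-a * (r * q)) = -(1 / r) by field_simp,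
    show a * q / (-a * -(r * q)) = 1 / r by field_simp,
    show a * q / (r * q * -(r * q)) = -b by rw [har]; field_simp,
    show a * q / -a = -1 * q by field_simp,
    show a * q / (-a * (r * q) * -(r * q)) = b / a by rw [har]; field_simp,
    show -q = -1 * q by ring, hrq', hrq, sh _ hr3, sh _ hr4, sh _ hb1, sh _ hC0, sh _ hD0, sh _ n1]
  have n2 : ellTheta (-1 * q ^ n) p ≠ 0 := by
    rw [neg_one_mul]
    exact hQ0 n le_rfl
  have n3 := hC n
  have n4 := hD n
  rw [show -(1 / (r * q) * q ^ n) = -(1 / (r * q)) * q ^ n by ring,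
    show -(a / r * q ^ n) = -(a / r) * q ^ n by ring,
    show -(b * q ^ n) = -b * q ^ n by ring, show -q ^ n = -1 * q ^ n by ring] at key
  generalize ellFac (-1) q p n = F1
  generalize ellFac (b / a) q p n = F2
  generalize ellFac (a / r) q p n = F3
  generalize ellFac (-(a / r)) q p n = F4
  generalize ellFac (a * q) q p n = F5
  generalize ellFac (1 / (r * q)) q p n = F6
  generalize ellFac (-(1 / (r * q))) q p n = F7
  generalize ellFac (-b) q p n = F8
  generalize ellTheta (-1) p = t1 at *
  generalize ellTheta (-1 * q ^ n) p = t2 at *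
  generalize ellTheta (a / r * q ^ n) p = t3 at *
  generalize ellTheta (-(a / r) * q ^ n) p = t4 at *
  generalize ellTheta (1 / (r * q)) p = t5 at *
  generalize ellTheta (-(1 / (r * q))) p = t6 at *
  generalize ellTheta (a / r) p = t7 at *
  generalize ellTheta (-(a / r)) p = t8 at *
  generalize ellTheta (1 / (r * q) * q ^ n) p = t9 at *
  generalize ellTheta (-(1 / (r * q)) * q ^ n) p = s1 at *
  generalize ellTheta (-b) p = s2 at *
  generalize ellTheta (-b * q ^ n) p = s3 at *
  generalize ellTheta (-(b * q ^ (2 * n))) p = s4 at *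
  clear sh f1 f2 f3 hA hQ hQ' hC hD hE hC' hD' hQ2 hCq hDq hQ0
  trans F5 * F6 * F7 * F8 / (F1 * F2 * F3 * F4) * (t9 / t5 * (s3 / s2) * (t8 / t4)
      + s1 / t6 * (s3 / s2) * (t7 / t3) - t9 / t5 * (s1 / t6) * (t1 / t2))
  · simp only [div_eq_mul_inv, mul_inv, inv_inv]
    ring
  trans F5 * F6 * F7 * F8 / (F1 * F2 * F3 * F4)
    * (q ^ n * (s4 / s2) * (t1 / t2) * (t7 / t3) * (t8 / t4))
  · congr 1
    field_simp
    linear_combination -key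
  · simp only [div_eq_mul_inv, mul_inv, inv_inv]
    ring

/-! ### Bailey kernels -/

/-- The matrix relating the two sequences of a Bailey pair with parameters `A` and `K`. It is lower
triangular: only entries with `j ≤ n` are meaningful, as `n - j` is truncated subtraction. -/
noncomputable def baileyKernel (A K q p : ℂ) (n j : ℕ) : ℂ :=
  ellFac K q p (n + j) * ellFac (K / A) q p (n - j)
    / (ellFac q q p (n - j) * ellFac (A * q) q p (n + j))

/-- Shifting both indices amounts to shifting both parameters. -/
theorem baileyKernel_add_add (A K : ℂ) {q : ℂ} (p : ℂ) (hq : q ≠ 0) (j m i : ℕ) :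
    baileyKernel A K q p (j + m) (j + i) = ellFac K q p (2 * j) / ellFac (A * q) q p (2 * j)
      * baileyKernel (A * q ^ (2 * j)) (K * q ^ (2 * j)) q p m i := by
  unfold baileyKernel
  rw [show j + m + (j + i) = 2 * j + (m + i) by ring, Nat.add_sub_add_left, ellFac_add K,
    ellFac_add (A * q), mul_div_mul_right _ _ (pow_ne_zero _ hq), mul_right_comm A]
  ring

/-- Writing the kernel as a multiple of the factors of a terminating series. -/
theorem baileyKernel_eq {A K q p : ℂ} (hp : ‖p‖ < 1) (hA : A ≠ 0) (hK : K ≠ 0) (hq : q ≠ 0)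
    {n k : ℕ} (hk : k ≤ n) (h1 : ellFac (K / A) q p n ≠ 0) (h2 : ellFac q q p n ≠ 0) :
    baileyKernel A K q p n k = ellFac K q p n * ellFac (K / A) q p n
        / (ellFac q q p n * ellFac (A * q) q p n)
      * (ellFac (K * q ^ n) q p k * ellFac (1 / q ^ n) q p k
        / (ellFac (A * q / (K * q ^ n)) q p k * ellFac (A * q * q ^ n) q p k))
      * (A * q / K) ^ k := by
  obtain ⟨m, rfl⟩ := Nat.exists_eq_add_of_le' hk
  have h := ellFac_reverse_div (x := q * q ^ m) (y := K / A * q ^ m) (q := q) (p := p)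
    (by positivity) (by positivity) hq hp k
  rw [show q / (q * q ^ m * q ^ k) = 1 / q ^ (m + k) by rw [pow_add]; field_simp,
    show q / (K / A * q ^ m * q ^ k) = A * q / (K * q ^ (m + k)) by rw [pow_add]; field_simp,
    show K / A * q ^ m / (q * q ^ m) = K / (A * q) by field_simp] at h
  have e1 : ellFac (K / A) q p (m + k) = _ := ellFac_add _ _ _ m k
  have e2 : ellFac q q p (m + k) = _ := ellFac_add _ _ _ m k
  rw [e1] at h1
  rw [e2] at h2
  have h11 := right_ne_zero_of_mul h1
  have h22 := right_ne_zero_of_mul h2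
  unfold baileyKernel
  rw [ellFac_add K _ _ (m + k) k, ellFac_add (A * q) _ _ (m + k) k, Nat.add_sub_cancel, e1, e2]
  trans ellFac K q p (m + k) * (ellFac (K / A) q p m * ellFac (K / A * q ^ m) q p k)
        / (ellFac q q p m * ellFac (q * q ^ m) q p k * ellFac (A * q) q p (m + k))
      * (ellFac (K * q ^ (m + k)) q p k * (ellFac (1 / q ^ (m + k)) q p k
        / ellFac (A * q / (K * q ^ (m + k))) q p k) / ellFac (A * q * q ^ (m + k)) q p k)
      * (A * q / K) ^ k
  · rw [h]
    have h3 : (A * q / K) ^ k * (K / (A * q)) ^ k = 1 := by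
      rw [← mul_pow, show A * q / K * (K / (A * q)) = 1 by field_simp, one_pow]
    have h4 := mul_inv_cancel₀ h11
    have h5 := mul_inv_cancel₀ h22
    generalize ellFac (K / A * q ^ m) q p k = U at *
    generalize ellFac (q * q ^ m) q p k = V at *
    generalize (A * q / K) ^ k = X at *
    generalize (K / (A * q)) ^ k = Y at *
    trans ellFac K q p (m + k) * ellFac (K * q ^ (m + k)) q p k * ellFac (K / A) q p m
        / (ellFac q q p m * (ellFac (A * q) q p (m + k) * ellFac (A * q * q ^ (m + k)) q p k))
        * (X * Y) * (U * U⁻¹) * (V * V⁻¹)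
    · rw [h3, h4, h5]
      ring
    · ring
  · ring

/-- Parameters in general position, relative to `q` and `p`: none of `a`, `-a`, `b`, `-b`, `a/b`
times a power of `q` is a zero of `θ(·; p)`, and `ab` times a power of `q` is not a zero of
`θ(·; p²)`. This covers all denominators that depend on `a` or `b`. -/
structure ThetaGeneric (a b q p : ℂ) : Prop where
  left : ∀ m : ℤ, ellTheta (a * q ^ m) p ≠ 0
  neg_left : ∀ m : ℤ, ellTheta (-a * q ^ m) p ≠ 0
  right : ∀ m : ℤ, ellTheta (b * q ^ m) p ≠ 0
  neg_right : ∀ m : ℤ, ellTheta (-b * q ^ m) p ≠ 0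
  mul : ∀ m : ℤ, ellTheta (a * b * q ^ m) (p ^ 2) ≠ 0
  div : ∀ m : ℤ, ellTheta (a / b * q ^ m) p ≠ 0

theorem ThetaGeneric.shift {a b q p : ℂ} (h : ThetaGeneric a b q p) (hq : q ≠ 0) (j : ℕ) :
    ThetaGeneric (a * q ^ j) (b * q ^ j) q p := by
  have e : ∀ (x : ℂ) (m : ℤ), x * q ^ j * q ^ m = x * q ^ ((j : ℤ) + m) := fun x m => by
    rw [zpow_add₀ hq, zpow_natCast, mul_assoc]
  refine ⟨fun m => ?_, fun m => ?_, fun m => ?_, fun m => ?_, fun m => ?_, fun m => ?_⟩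
  · rw [e]
    exact h.left _
  · rw [neg_mul_eq_neg_mul, e]
    exact h.neg_left _
  · rw [e]
    exact h.right _
  · rw [neg_mul_eq_neg_mul, e]
    exact h.neg_right _
  · rw [show a * q ^ j * (b * q ^ j) * q ^ m = a * b * q ^ j * q ^ j * q ^ m by ring, mul_assoc,
      ← zpow_natCast, ← zpow_add₀ hq, mul_assoc, ← zpow_add₀ hq]
    exact h.mul _
  · rw [mul_div_mul_right _ _ (pow_ne_zero j hq)]
    exact h.div m

theorem ThetaGeneric.swap {a b q p : ℂ} (h : ThetaGeneric a b q p) (hp : ‖p‖ < 1) (hq : q ≠ 0)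
    (ha : a ≠ 0) (hb : b ≠ 0) : ThetaGeneric b a q p := by
  refine ⟨h.right, h.neg_right, h.left, h.neg_left, fun m => ?_, fun m => ?_⟩
  · rw [mul_comm b]
    exact h.mul m
  · have := ellTheta_inv_ne_zero (mul_ne_zero (div_ne_zero ha hb) (zpow_ne_zero (-m) hq)) hp
      (h.div (-m))
    rwa [zpow_neg, show 1 / (a / b * (q ^ m)⁻¹) = b / a * q ^ m by field_simp] at this

theorem ellFac_ne_zero_of_zpow {x q p : ℂ} (h : ∀ m : ℤ, ellTheta (x * q ^ m) p ≠ 0) (k : ℕ) :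
    ellFac x q p k ≠ 0 :=
  ellFac_ne_zero fun i _ => by simpa using h i

/-- The case `j = 0` of `sum_baileyKernel_mul_baileyKernel`. -/
theorem sum_baileyKernel_mul_baileyKernel_zero {a b q p : ℂ} {n : ℕ} (hp : ‖p‖ < 1) (hq : q ≠ 0)
    (ha : a ≠ 0) (hb : b ≠ 0) (h : ThetaGeneric a b q p)
    (hQ : ∀ j < n, ellTheta (q ^ (j + 1)) p ≠ 0) (hQ' : ∀ j < n, ellTheta (-q ^ (j + 1)) p ≠ 0) :
    ∑ k ∈ Finset.range (n + 1), baileyKernel a b q p n k * (b * q / a) ^ k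
        * ellTheta (a ^ 2 * q ^ (4 * k)) (p ^ 2)
        * baileyKernel (a * b * q) (a ^ 2) (q ^ 2) (p ^ 2) k 0
      = q ^ n * ellTheta (-(b * q ^ (2 * n))) p
        * baileyKernel (a * b * q) (b ^ 2) (q ^ 2) (p ^ 2) n 0
        * (ellTheta a p * ellTheta (-a) p / ellTheta (-b) p) := by
  -- With `r² = a/(bq)`, factorials of `a²`, `a/(bq)`, `abq³` in base `q²` and nome `p²` split into
  -- factorials of `±a`, `±r`, `±aq/r` in base `q` and nome `p`.
  obtain ⟨r, hr, hr2⟩ := exists_sq_eq (div_ne_zero ha (mul_ne_zero hb hq))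
  have har : a = b * q * r ^ 2 := by
    rw [← hr2]
    field_simp
  have hsq : ∀ x y : ℂ, x ^ 2 = y → ellTheta y (p ^ 2) ≠ 0 →
      ellTheta x p ≠ 0 ∧ ellTheta (-x) p ≠ 0 := by
    rintro x _ rfl hy
    rw [ellTheta_sq _ hp] at hy
    exact mul_ne_zero_iff.1 hy
  have hn : ∀ {x : ℂ} (j : ℕ), (∀ m : ℤ, ellTheta (x * q ^ m) p ≠ 0) →
      ellTheta (x * q ^ j) p ≠ 0 := fun j hx => by simpa using hx j
  have h0 : ∀ {x : ℂ}, (∀ m : ℤ, ellTheta (x * q ^ m) p ≠ 0) → ellTheta x p ≠ 0 :=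
    fun hx => by simpa using hx 0
  have hs := h.swap hp hq ha hb
  obtain ⟨r1, r2⟩ := hsq r (a / b * q ^ (-1 : ℤ)) (by rw [← hr2, zpow_neg_one]; field_simp)
    (ellTheta_sq_nome_ne_zero hp (h.div _))
  obtain ⟨r3, r4⟩ := hsq (1 / (r * q)) (b / a * q ^ (-1 : ℤ))
    (by rw [div_pow, mul_pow, ← hr2, zpow_neg_one]; field_simp)
    (ellTheta_sq_nome_ne_zero hp (hs.div _))
  have hCD : ∀ j : ℕ, ellTheta (a / r * q ^ j) p ≠ 0 ∧ ellTheta (-(a / r * q ^ j)) p ≠ 0 := by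
    intro j
    refine hsq _ (a * b * q ^ ((2 * j + 1 : ℕ) : ℤ)) ?_ (h.mul _)
    rw [mul_pow, div_pow, ← hr2, zpow_natCast]
    field_simp
    ring
  have hE : ∀ j : ℕ, ellTheta (a * q ^ j / (b * q ^ n)) p ≠ 0 := by
    intro j
    rw [show a * q ^ j / (b * q ^ n) = a / b * q ^ ((j : ℤ) - n) by
      rw [zpow_sub₀ hq, zpow_natCast, zpow_natCast]
      field_simp]
    exact h.div _
  have key := sum_vwpTerm_quadratic hp hq hb hr har (fun j => hn j h.left) (h0 h.neg_left) hQ hQ'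
    (h0 h.neg_right) r1 r2 r3 r4 (fun j => (hCD j).1)
    (fun j => by rw [← neg_mul_eq_neg_mul]; exact (hCD j).2) hE
  have q1 : ellFac q q p n ≠ 0 := ellFac_ne_zero fun j hj => by
    rw [← pow_succ']
    exact hQ j hj
  have hba : ellFac (b / a) q p n ≠ 0 := ellFac_ne_zero_of_zpow hs.div n
  have n1 := h0 h.left
  have n2 := h0 h.neg_left
  have e1 : a ^ 2 / (a * b * q) = r ^ 2 := by
    rw [har]
    field_simp
  have e2 : a * b * q * q ^ 2 = (a / r * q) ^ 2 := by
    rw [mul_pow, div_pow, ← hr2]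
    field_simp
  have e3 : b ^ 2 / (a * b * q) = (1 / (r * q)) ^ 2 := by
    rw [div_pow, mul_pow, ← hr2]
    field_simp
  have hterm : ∀ k ∈ Finset.range (n + 1), baileyKernel a b q p n k * (b * q / a) ^ k
        * ellTheta (a ^ 2 * q ^ (4 * k)) (p ^ 2)
        * baileyKernel (a * b * q) (a ^ 2) (q ^ 2) (p ^ 2) k 0
      = ellFac b q p n * ellFac (b / a) q p n / (ellFac q q p n * ellFac (a * q) q p n)
        * (ellTheta a p * ellTheta (-a) p)
        * (vwpTerm a (-a) r (-r) (b * q ^ n) (1 / q ^ n) q p k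
          * (q ^ k * (ellTheta (-(a * q ^ (2 * k))) p / ellTheta (-a) p))) := by
    intro k hk
    rw [baileyKernel_eq hp ha hb hq (Nat.lt_succ_iff.1 (Finset.mem_range.1 hk)) hba q1,
      baileyKernel, add_zero, Nat.sub_zero, e1, e2, ellFac_sq _ _ hp, ellFac_sq _ _ hp,
      ellFac_sq _ _ hp, ellFac_sq _ _ hp,
      show a ^ 2 * q ^ (4 * k) = (a * q ^ (2 * k)) ^ 2 by ring, ellTheta_sq _ hp, vwpTerm,
      show a * q / -a = -q by field_simp, show a * q / -r = -(a / r * q) by rw [div_neg]; ring,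
      show a * q / r = a / r * q by ring, show a * q / (1 / q ^ n) = a * q * q ^ n by field_simp]
    have h3 : (a * q / b) ^ k * (b * q / a) ^ k = q ^ k * q ^ k := by
      rw [← mul_pow, ← mul_pow, show a * q / b * (b * q / a) = q * q by field_simp]
    have h4 := mul_inv_cancel₀ n1
    have h5 := mul_inv_cancel₀ n2
    generalize ellFac b q p n * ellFac (b / a) q p n / (ellFac q q p n * ellFac (a * q) q p n) = C
    generalize (a * q / b) ^ k = X at *
    generalize (b * q / a) ^ k = Y at *
    generalize ellTheta a p = t1 at *
    generalize ellTheta (-a) p = t2 at *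
    have h6 : ∀ M : ℂ, M * (X * Y) = M * (q ^ k * q ^ k) * (t1 * t1⁻¹) * (t2 * t2⁻¹) := fun M => by
      rw [h3, h4, h5, mul_one, mul_one]
    refine Eq.trans ?_ ((h6 (C * (ellTheta (a * q ^ (2 * k)) p * ellTheta (-(a * q ^ (2 * k))) p)
      * (ellFac (b * q ^ n) q p k * ellFac (1 / q ^ n) q p k
        / (ellFac (a * q / (b * q ^ n)) q p k * ellFac (a * q * q ^ n) q p k))
      * (ellFac a q p k * ellFac (-a) q p k * (ellFac r q p k * ellFac (-r) q p k)
        / (ellFac q q p k * ellFac (-q) q p k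
          * (ellFac (a / r * q) q p k * ellFac (-(a / r * q)) q p k))))).trans ?_)
    · ring
    · ring
  rw [Finset.sum_congr rfl hterm, ← Finset.mul_sum, key, baileyKernel, add_zero, Nat.sub_zero, e2,
    e3, ellFac_sq _ _ hp, ellFac_sq _ _ hp, ellFac_sq _ _ hp, ellFac_sq _ _ hp,
    show -(a / r * q) = -(a / r) * q by ring]
  have h3 := mul_inv_cancel₀ (ellFac_ne_zero_of_zpow (x := a * q) (fun m => by
    rw [mul_assoc, ← zpow_one_add₀ hq]
    exact h.left _) n)
  have h4 := mul_inv_cancel₀ hba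
  generalize ellFac (a * q) q p n = U at *
  generalize ellFac (b / a) q p n = V at *
  have h6 : ∀ M : ℂ, M * (U * U⁻¹) * (V * V⁻¹) = M := fun M => by rw [h3, h4, mul_one, mul_one]
  refine Eq.trans ?_ ((h6 (ellFac b q p n * (ellTheta a p * ellTheta (-a) p)
      * (q ^ n * ellTheta (-(b * q ^ (2 * n))) p * ellFac (-b) q p n
        * (ellFac (1 / (r * q)) q p n * ellFac (-(1 / (r * q))) q p n)) / (ellFac q q p n
        * (ellTheta (-b) p * ellFac (-q) q p n * (ellFac (a / r * q) q p n
          * ellFac (-(a / r) * q) q p n))))).trans ?_)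
  · ring
  · ring

theorem ThetaGeneric.ellFac_left_mul_ne_zero {a b q p : ℂ} (h : ThetaGeneric a b q p) (hq : q ≠ 0)
    (k : ℕ) : ellFac (a * q) q p k ≠ 0 :=
  ellFac_ne_zero_of_zpow (fun m => by
    rw [mul_assoc, ← zpow_one_add₀ hq]
    exact h.left _) k

/-- Composing a kernel in base `q` with a kernel in base `q²` and nome `p²` gives again a kernel in
base `q²` and nome `p²`. -/
theorem sum_baileyKernel_mul_baileyKernel {a b q p : ℂ} (j : ℕ) {m : ℕ} (hp : ‖p‖ < 1)
    (hq : q ≠ 0) (ha : a ≠ 0) (hb : b ≠ 0) (h : ThetaGeneric a b q p)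
    (hQ : ∀ j < m, ellTheta (q ^ (j + 1)) p ≠ 0) (hQ' : ∀ j < m, ellTheta (-q ^ (j + 1)) p ≠ 0) :
    ∑ i ∈ Finset.range (m + 1), baileyKernel a b q p (j + m) (j + i) * (b * q / a) ^ (j + i)
        * ellTheta (a ^ 2 * q ^ (4 * (j + i))) (p ^ 2)
        * baileyKernel (a * b * q) (a ^ 2) (q ^ 2) (p ^ 2) (j + i) j
      = q ^ (j + m) * ellTheta (-(b * q ^ (2 * (j + m)))) p
        * baileyKernel (a * b * q) (b ^ 2) (q ^ 2) (p ^ 2) (j + m) j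
        * ((b / a) ^ j * ellTheta a p * ellFac (-a) q p (2 * j + 1)
          / ellFac (-b) q p (2 * j + 1)) := by
  have hj := pow_ne_zero (2 * j) hq
  have hq2 := pow_ne_zero 2 hq
  have key := sum_baileyKernel_mul_baileyKernel_zero hp hq (mul_ne_zero ha hj) (mul_ne_zero hb hj)
    (h.shift hq (2 * j)) hQ hQ'
  have e1 : a * q ^ (2 * j) * (b * q ^ (2 * j)) * q = a * b * q * (q ^ 2) ^ (2 * j) := by ring
  have e2 : ∀ x : ℂ, (x * q ^ (2 * j)) ^ 2 = x ^ 2 * (q ^ 2) ^ (2 * j) := fun x => by ring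
  have e3 : b * q ^ (2 * j) * q / (a * q ^ (2 * j)) = b * q / a := by
    field_simp
  have hK : ∀ x : ℂ, ∀ i, baileyKernel (a * b * q) (x ^ 2) (q ^ 2) (p ^ 2) (j + i) j = _ :=
    fun x i => baileyKernel_add_add (a * b * q) (x ^ 2) (p ^ 2) hq2 j i 0
  simp only [e1, e2, e3] at key
  simp only [hK, baileyKernel_add_add a b p hq]
  have hterm : ∀ i ∈ Finset.range (m + 1),
      ellFac b q p (2 * j) / ellFac (a * q) q p (2 * j)
        * baileyKernel (a * q ^ (2 * j)) (b * q ^ (2 * j)) q p m i * (b * q / a) ^ (j + i)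
        * ellTheta (a ^ 2 * q ^ (4 * (j + i))) (p ^ 2)
        * (ellFac (a ^ 2) (q ^ 2) (p ^ 2) (2 * j)
          / ellFac (a * b * q * q ^ 2) (q ^ 2) (p ^ 2) (2 * j)
          * baileyKernel (a * b * q * (q ^ 2) ^ (2 * j)) (a ^ 2 * (q ^ 2) ^ (2 * j)) (q ^ 2) (p ^ 2)
            i 0)
      = ellFac b q p (2 * j) / ellFac (a * q) q p (2 * j) * (b * q / a) ^ j
        * (ellFac (a ^ 2) (q ^ 2) (p ^ 2) (2 * j)
          / ellFac (a * b * q * q ^ 2) (q ^ 2) (p ^ 2) (2 * j))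
        * (baileyKernel (a * q ^ (2 * j)) (b * q ^ (2 * j)) q p m i * (b * q / a) ^ i
          * ellTheta (a ^ 2 * (q ^ 2) ^ (2 * j) * q ^ (4 * i)) (p ^ 2)
          * baileyKernel (a * b * q * (q ^ 2) ^ (2 * j)) (a ^ 2 * (q ^ 2) ^ (2 * j)) (q ^ 2) (p ^ 2)
            i 0) := by
    intro i _
    rw [show a ^ 2 * q ^ (4 * (j + i)) = a ^ 2 * (q ^ 2) ^ (2 * j) * q ^ (4 * i) by ring, pow_add]
    ring
  rw [Finset.sum_congr rfl hterm, ← Finset.mul_sum, key, ellFac_sq a q hp, ellFac_sq b q hp,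
    ellFac_succ, ellFac_succ, show b * q ^ (2 * j) * q ^ (2 * m) = b * q ^ (2 * (j + m)) by ring,
    ← neg_mul a, ← neg_mul b, pow_add q j m, div_pow, div_pow, mul_pow]
  have n1 := mul_inv_cancel₀ (h.ellFac_left_mul_ne_zero hq (2 * j))
  have n2 := mul_inv_cancel₀ (ellFac_ne_zero_of_zpow h.neg_right (2 * j))
  have h1 := ellFac_mul_shift a q p (2 * j)
  generalize ellFac (a * q) q p (2 * j) = U at *
  generalize ellFac (-b) q p (2 * j) = V at *
  generalize ellFac a q p (2 * j) = W at *
  generalize ellTheta (a * q ^ (2 * j)) p = X at *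
  generalize ellTheta a p = Y at *
  have h6 : ∀ M : ℂ, M * (W * X) * U⁻¹ = M * Y * (V * V⁻¹) := fun M => by
    rw [← h1, n2]
    linear_combination M * Y * n1
  refine Eq.trans ?_ ((h6 (ellFac b q p (2 * j) * (b ^ j * q ^ j / a ^ j) * (ellFac (-a) q p (2 * j)
      / ellFac (a * b * q * q ^ 2) (q ^ 2) (p ^ 2) (2 * j)) * (q ^ m
      * ellTheta (-(b * q ^ (2 * (j + m)))) p * baileyKernel (a * b * q * (q ^ 2) ^ (2 * j))
        (b ^ 2 * (q ^ 2) ^ (2 * j)) (q ^ 2) (p ^ 2) m 0)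
      * (ellTheta (-a * q ^ (2 * j)) p / ellTheta (-b * q ^ (2 * j)) p))).trans ?_)
  · ring_nf
  · ring_nf

/-! ### Inversion of a Bailey kernel -/

theorem sum_range_sum_range_succ (n : ℕ) (f : ℕ → ℕ → ℂ) :
    ∑ j ∈ Finset.range (n + 1), ∑ l ∈ Finset.range (j + 1), f j l
      = ∑ l ∈ Finset.range (n + 1), ∑ i ∈ Finset.range (n - l + 1), f (l + i) l := by
  have h := Finset.sum_Ico_Ico_comm 0 (n + 1) fun l j => f j l
  simp only [← Finset.range_eq_Ico] at h
  rw [← h]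
  refine Finset.sum_congr rfl fun l hl => ?_
  rw [Finset.sum_Ico_eq_sum_range, Nat.sub_add_comm (Nat.lt_succ_iff.1 (Finset.mem_range.1 hl))]

/-- The inverse of the lower triangular matrix `baileyKernel A K q p`. Up to diagonal factors it is
the kernel with `A` and `K` interchanged. Only entries with `l ≤ j` are meaningful. -/
noncomputable def baileyKernelInv (A K q p : ℂ) (j l : ℕ) : ℂ :=
  ellTheta (A * q ^ (2 * j)) p / ellTheta A p * (ellTheta (K * q ^ (2 * l)) p / ellTheta K p)
    * baileyKernel K A q p j l * (K / A) ^ (j - l)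

/-- The entry of index `(l + m, l)` of the product of a kernel with its inverse. For `m > 0` it is a
multiple of a telescoping sum whose closed form contains the factor `θ(1) = 0`. -/
theorem sum_baileyKernel_mul_inv {A K q p : ℂ} (hp : ‖p‖ < 1) (hq : q ≠ 0) (hA0 : A ≠ 0)
    (hK0 : K ≠ 0) (hA : ∀ m : ℤ, ellTheta (A * q ^ m) p ≠ 0)
    (hK : ∀ m : ℤ, ellTheta (K * q ^ m) p ≠ 0) (hAK : ∀ m : ℤ, ellTheta (A / K * q ^ m) p ≠ 0)
    (l : ℕ) {m : ℕ} (hQ : ∀ j < m, ellTheta (q ^ (j + 1)) p ≠ 0) :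
    ∑ i ∈ Finset.range (m + 1), baileyKernel A K q p (l + m) (l + i)
      * baileyKernelInv A K q p (l + i) l = if m = 0 then 1 else 0 := by
  have hl := pow_ne_zero (2 * l) hq
  have hA' : ellTheta A p ≠ 0 := by simpa using hA 0
  have hK' : ellTheta K p ≠ 0 := by simpa using hK 0
  have hAq : ∀ k, ellFac (A * q) q p k ≠ 0 := ellFac_ne_zero_of_zpow fun m => by
    rw [mul_assoc, ← zpow_one_add₀ hq]
    exact hA _
  have hKq : ∀ k, ellFac (K * q) q p k ≠ 0 := ellFac_ne_zero_of_zpow fun m => by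
    rw [mul_assoc, ← zpow_one_add₀ hq]
    exact hK _
  rcases Nat.eq_zero_or_pos m with rfl | hm
  · have h1 := ellFac_mul_shift A q p (2 * l)
    have h2 := ellFac_mul_shift K q p (2 * l)
    simp only [zero_add, Finset.sum_range_one, add_zero, if_true, baileyKernelInv, baileyKernel,
      Nat.sub_self, ellFac_zero, mul_one, pow_zero, one_mul, ← two_mul]
    have h3 := hAq (2 * l)
    have h4 := hKq (2 * l)
    generalize ellFac (A * q) q p (2 * l) = U at *
    generalize ellFac (K * q) q p (2 * l) = V at *
    generalize ellTheta (A * q ^ (2 * l)) p = W at *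
    generalize ellTheta (K * q ^ (2 * l)) p = X at *
    field_simp
    linear_combination (-V * ellTheta K p) * h1 - ellFac A q p (2 * l) * W * h2
  rw [if_neg hm.ne']
  have hA3 : ellTheta (A * q ^ (2 * l)) p ≠ 0 := by
    have := hA (2 * l : ℕ)
    rwa [zpow_natCast] at this
  have hA2 : A * q ^ (2 * l) ≠ 0 := mul_ne_zero hA0 hl
  have hq' : ellFac q q p m ≠ 0 := ellFac_ne_zero fun j hj => by
    rw [← pow_succ']
    exact hQ j hj
  have hKA : ellFac (K * q ^ (2 * l) / (A * q ^ (2 * l))) q p m ≠ 0 := by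
    rw [mul_div_mul_right _ _ hl]
    refine ellFac_ne_zero_of_zpow (fun i => ?_) m
    have := ellTheta_inv_ne_zero (mul_ne_zero (div_ne_zero hA0 hK0) (zpow_ne_zero (-i) hq)) hp
      (hAK (-i))
    rwa [zpow_neg, show 1 / (A / K * (q ^ i)⁻¹) = K / A * q ^ i by field_simp] at this
  have tel := sum_telescoping (a := A * q ^ (2 * l)) (b := A / K) (c := 1 / q ^ m) (N := m) hp hq
    hA2 (div_ne_zero hA0 hK0) (one_div_ne_zero (pow_ne_zero m hq)) hA3 hQ
    (fun j _ => by
      rw [show A * q ^ (2 * l) * q ^ (j + 1) / (A / K) = K * q ^ ((2 * l + (j + 1) : ℕ) : ℤ) by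
        rw [zpow_natCast, pow_add]; field_simp; ring]
      exact hK _)
    (fun j _ => by
      rw [show A * q ^ (2 * l) * q ^ (j + 1) / (1 / q ^ m)
          = A * q ^ ((2 * l + (j + 1) + m : ℕ) : ℤ) by
        rw [zpow_natCast, pow_add, pow_add]; field_simp; ring]
      exact hA _)
    (fun j _ => by
      rw [show A / K * (1 / q ^ m) * q ^ (j + 1) = A / K * q ^ (((j + 1 : ℕ) : ℤ) - (m : ℤ)) by
        rw [zpow_sub₀ hq, zpow_natCast, zpow_natCast]; ring]
      exact hAK _)
  -- The factor `(q^{1-m})_m` of the telescoped sum vanishes.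
  have hz : ellFac (1 / q ^ m * q) q p m = 0 := by
    obtain ⟨m, rfl⟩ := Nat.exists_eq_add_of_le' hm
    rw [show 1 / q ^ (m + 1) * q = 1 / q ^ m by field_simp; ring]
    exact ellFac_one_div_pow_eq_zero hq p (Nat.lt_succ_self m)
  rw [hz, mul_zero, zero_mul, zero_div] at tel
  rw [← mul_zero (ellFac K q p (2 * l) / ellFac (A * q) q p (2 * l) * (
    ellFac (K * q ^ (2 * l)) q p m * ellFac (K / A) q p m
        / (ellFac q q p m * ellFac (A * q ^ (2 * l) * q) q p m))
    * (ellTheta (K * q ^ (2 * l)) p / (ellTheta A p * ellTheta K p))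
    * (ellFac A q p (2 * l) / ellFac (K * q) q p (2 * l)) * ellTheta (A * q ^ (2 * l)) p), ← tel,
    Finset.mul_sum]
  refine Finset.sum_congr rfl fun i hi => ?_
  have n1 := mul_inv_cancel₀ hA3
  rw [baileyKernelInv, baileyKernel_add_add A K p hq, Nat.add_sub_cancel_left,
    baileyKernel_eq hp hA2 (mul_ne_zero hK0 hl) hq (Nat.lt_succ_iff.1 (Finset.mem_range.1 hi))
      hKA hq', baileyKernel, Nat.add_sub_cancel_left, show l + i + l = 2 * l + i by ring,
    ellFac_add A, ellFac_add (K * q),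
    show A * q ^ (2 * l) / (A / K * (1 / q ^ m)) = K * q ^ (2 * l) * q ^ m by field_simp,
    show A * q ^ (2 * l) * q / (A / K) = K * q * q ^ (2 * l) by field_simp,
    show A * q ^ (2 * l) * q / (1 / q ^ m) = A * q ^ (2 * l) * q * q ^ m by field_simp,
    show A / K * (1 / q ^ m) * q = A * q ^ (2 * l) * q / (K * q ^ (2 * l) * q ^ m) by field_simp,
    mul_div_mul_right _ _ hl,
    show A * q ^ (2 * (l + i)) = A * q ^ (2 * l) * q ^ (2 * i) by ring,
    show A * q ^ (2 * l) * q / (K * q ^ (2 * l)) = A * q / K by field_simp]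
  have hX : (A * q / K) ^ i * (K / A) ^ i = q ^ i := by
    rw [← mul_pow, show A * q / K * (K / A) = q by field_simp]
  rw [← hX]
  generalize ellTheta (A * q ^ (2 * l)) p = t1 at *
  generalize (A * q / K) ^ i = X at *
  generalize (K / A) ^ i = Y at *
  have h6 : ∀ M : ℂ, M = M * (t1 * t1⁻¹) := fun M => by rw [n1, mul_one]
  refine (h6 _).trans ?_
  ring

/-- A Frenkel–Turaev sum with base `-a` in which two parameters are `±s q^j`, where `s² = abq`,
rewritten in terms of a kernel in base `q²` and nome `p²`. -/
theorem sum_baileyKernel_mul_ellFac {a b q p : ℂ} {j : ℕ} (hp : ‖p‖ < 1) (hq : q ≠ 0)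
    (ha : a ≠ 0) (hb : b ≠ 0) (h : ThetaGeneric a b q p)
    (hQ : ∀ i < j, ellTheta (q ^ (i + 1)) p ≠ 0) (hQ' : ∀ i < j, ellTheta (-q ^ (i + 1)) p ≠ 0) :
    ∑ l ∈ Finset.range (j + 1), baileyKernel (a ^ 2) (a * b * q) (q ^ 2) (p ^ 2) j l
        * (a ^ 2 / (a * b * q)) ^ (j - l) * (1 / q ^ l * (ellTheta (-a * q ^ (2 * l)) p
          / ellTheta (-a) p * (ellFac (-a) q p l * ellFac (a / b) q p l
            / (ellFac q q p l * ellFac (-b * q) q p l))))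
      = 1 / q ^ j * (ellFac (a * b * q) (q ^ 2) (p ^ 2) j * ellFac (a * q / b) (q ^ 2) (p ^ 2) j
          / (ellFac (q ^ 2) (q ^ 2) (p ^ 2) j * ellFac (b ^ 2 * q ^ 2) (q ^ 2) (p ^ 2) j))
        * (ellFac (b * q) q p (2 * j) / ellFac (a * q) q p (2 * j)) := by
  have hp2 := norm_sq_lt_one hp
  have hA : a * b * q ≠ 0 := mul_ne_zero (mul_ne_zero ha hb) hq
  have hq2 := pow_ne_zero 2 hq
  have hqj := pow_ne_zero j hq
  have hs := h.swap hp hq ha hb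
  obtain ⟨s, hs0, hs2⟩ := exists_sq_eq hA
  have hn : ∀ {x : ℂ} (i : ℕ), (∀ m : ℤ, ellTheta (x * q ^ m) p ≠ 0) →
      ellTheta (x * q ^ i) p ≠ 0 := fun i hx => by simpa using hx i
  have hCD : ∀ i : ℕ, ellTheta (a * q ^ (i + 1) / (s * q ^ j)) p ≠ 0
      ∧ ellTheta (-(a * q ^ (i + 1) / (s * q ^ j))) p ≠ 0 := by
    intro i
    have h1 := ellTheta_sq_nome_ne_zero hp (h.div ((2 * i + 1 : ℕ) - (2 * j : ℕ)))
    rw [show a / b * q ^ (((2 * i + 1 : ℕ) : ℤ) - (2 * j : ℕ))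
        = (a * q ^ (i + 1) / (s * q ^ j)) ^ 2 by
      rw [div_pow, mul_pow s, ← hs2, zpow_sub₀ hq, zpow_natCast, zpow_natCast]
      field_simp
      ring, ellTheta_sq _ hp] at h1
    exact mul_ne_zero_iff.1 h1
  have ft := sum_vwpTerm (a := -a) (b := a / b) (c := s * q ^ j) (d := -(s * q ^ j))
    (e := -(1 / q ^ j)) hp hq j (neg_ne_zero.2 ha) (div_ne_zero ha hb) (mul_ne_zero hs0 hqj)
    (neg_ne_zero.2 (mul_ne_zero hs0 hqj))
    (by
      rw [show a / b * (s * q ^ j) * -(s * q ^ j) * -(1 / q ^ j) = a / b * s ^ 2 * q ^ j by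
        field_simp, ← hs2]
      field_simp
      ring)
    (fun i => hn i h.neg_left) hQ
    (fun i _ => by
      rw [show -a * q ^ (i + 1) / (a / b) = -b * q ^ (i + 1) by field_simp]
      exact hn _ h.neg_right)
    (fun i _ => by
      rw [show -a * q ^ (i + 1) / (s * q ^ j) = -(a * q ^ (i + 1) / (s * q ^ j)) by ring]
      exact (hCD i).2)
    (fun i _ => by
      rw [show -a * q ^ (i + 1) / -(s * q ^ j) = a * q ^ (i + 1) / (s * q ^ j) by
        rw [div_neg]; ring]
      exact (hCD i).1)
    (fun i => by
      rw [show -a * q ^ i / -(1 / q ^ j) = a * q ^ (i + j) by rw [pow_add]; field_simp]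
      exact hn _ h.left)
  have hQ2 : ellFac (q ^ 2) (q ^ 2) (p ^ 2) j ≠ 0 := by
    rw [ellFac_sq _ _ hp]
    refine mul_ne_zero (ellFac_ne_zero fun i hi => ?_) (ellFac_ne_zero fun i hi => ?_)
    · rw [← pow_succ']
      exact hQ i hi
    · rw [neg_mul, ← pow_succ']
      exact hQ' i hi
  have hKA : ellFac (a * b * q / a ^ 2) (q ^ 2) (p ^ 2) j ≠ 0 := ellFac_ne_zero fun i _ => by
    rw [show a * b * q / a ^ 2 * (q ^ 2) ^ i = b / a * q ^ ((1 + 2 * i : ℕ) : ℤ) by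
      rw [zpow_natCast, pow_add, pow_mul]
      field_simp]
    exact ellTheta_sq_nome_ne_zero hp (hs.div _)
  have hterm : ∀ l ∈ Finset.range (j + 1), baileyKernel (a ^ 2) (a * b * q) (q ^ 2) (p ^ 2) j l
        * (a ^ 2 / (a * b * q)) ^ (j - l) * (1 / q ^ l * (ellTheta (-a * q ^ (2 * l)) p
          / ellTheta (-a) p * (ellFac (-a) q p l * ellFac (a / b) q p l
            / (ellFac q q p l * ellFac (-b * q) q p l))))
      = (a ^ 2 / (a * b * q)) ^ j * (ellFac (a * b * q) (q ^ 2) (p ^ 2) j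
          * ellFac (a * b * q / a ^ 2) (q ^ 2) (p ^ 2) j
        / (ellFac (q ^ 2) (q ^ 2) (p ^ 2) j * ellFac (a ^ 2 * q ^ 2) (q ^ 2) (p ^ 2) j))
        * vwpTerm (-a) (a / b) (s * q ^ j) (-(s * q ^ j)) (-(1 / q ^ j)) (1 / q ^ j) q p l := by
    intro l hl
    have hl := Nat.lt_succ_iff.1 (Finset.mem_range.1 hl)
    rw [baileyKernel_eq hp2 (pow_ne_zero 2 ha) hA hq2 hl hKA hQ2, vwpTerm,
      show a * b * q * (q ^ 2) ^ j = (s * q ^ j) ^ 2 by rw [mul_pow, ← hs2]; ring,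
      show 1 / (q ^ 2) ^ j = (1 / q ^ j) ^ 2 by ring,
      show a ^ 2 * q ^ 2 / (s * q ^ j) ^ 2 = (a * q / (s * q ^ j)) ^ 2 by ring,
      show a ^ 2 * q ^ 2 * (q ^ 2) ^ j = (a * q * q ^ j) ^ 2 by ring,
      show -a * q / (a / b) = -b * q by field_simp,
      show -a * q / (s * q ^ j) = -(a * q / (s * q ^ j)) by ring,
      show -a * q / -(s * q ^ j) = a * q / (s * q ^ j) by rw [div_neg]; ring,
      show -a * q / -(1 / q ^ j) = a * q * q ^ j by field_simp,
      show -a * q / (1 / q ^ j) = -(a * q * q ^ j) by field_simp]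
    have hX : (a ^ 2 / (a * b * q)) ^ (j - l) * (a ^ 2 * q ^ 2 / (a * b * q)) ^ l * (1 / q ^ l)
        = (a ^ 2 / (a * b * q)) ^ j * q ^ l := by
      obtain ⟨m, rfl⟩ := Nat.exists_eq_add_of_le hl
      rw [Nat.add_sub_cancel_left, mul_comm (a ^ 2), mul_div_assoc, mul_pow, pow_add,
        ← pow_mul, mul_comm 2 l, pow_mul]
      field_simp
    simp only [ellFac_sq _ _ hp]
    generalize ellFac (a * b * q) (q ^ 2) (p ^ 2) j
          * ellFac (a * b * q / a ^ 2) (q ^ 2) (p ^ 2) j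
        / (ellFac q q p j * ellFac (-q) q p j * ellFac (a ^ 2 * q ^ 2) (q ^ 2) (p ^ 2) j) = C
    generalize (a ^ 2 / (a * b * q)) ^ (j - l) = X1 at *
    generalize (a ^ 2 * q ^ 2 / (a * b * q)) ^ l = X2 at *
    generalize (a ^ 2 / (a * b * q)) ^ j = X3 at *
    generalize 1 / q ^ l = X4 at *
    have h6 : ∀ M : ℂ, M * (X1 * X2 * X4) = M * (X3 * q ^ l) := fun M => by rw [hX]
    refine Eq.trans ?_ ((h6 (C * (ellFac (s * q ^ j) q p l * ellFac (-(s * q ^ j)) q p l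
      * (ellFac (1 / q ^ j) q p l * ellFac (-(1 / q ^ j)) q p l)
      / (ellFac (a * q / (s * q ^ j)) q p l * ellFac (-(a * q / (s * q ^ j))) q p l
        * (ellFac (a * q * q ^ j) q p l * ellFac (-(a * q * q ^ j)) q p l)))
      * (ellTheta (-a * q ^ (2 * l)) p / ellTheta (-a) p
        * (ellFac (-a) q p l * ellFac (a / b) q p l
          / (ellFac q q p l * ellFac (-b * q) q p l))))).trans ?_)
    · ring
    · ring
  have r1 := ellFac_reverse_div (x := a * q / b) (y := b * q / a) (q := q ^ 2) (p := p ^ 2)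
    (by positivity) (by positivity) hq2 hp2 j
  have r2 := ellFac_reverse_div (x := b * q ^ (j + 1)) (y := a * q ^ (j + 1)) (q := q) (p := p)
    (by positivity) (by positivity) hq hp j
  rw [show q ^ 2 / (a * q / b * (q ^ 2) ^ j) = (b * q / (s * q ^ j)) ^ 2 by
      rw [div_pow, mul_pow s, ← hs2]; field_simp; ring,
    show q ^ 2 / (b * q / a * (q ^ 2) ^ j) = (a * q / (s * q ^ j)) ^ 2 by
      rw [div_pow, mul_pow s, ← hs2]; field_simp; ring,
    show b * q / a / (a * q / b) = b ^ 2 / a ^ 2 by field_simp, ellFac_sq _ _ hp,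
    ellFac_sq _ _ hp] at r1
  rw [show a * q ^ (j + 1) / (b * q ^ (j + 1)) = a / b by field_simp] at r2
  rw [Finset.sum_congr rfl hterm, ← Finset.mul_sum, ft, ftProduct,
    show -a * q / (a / b * (s * q ^ j)) = -(b * q / (s * q ^ j)) by field_simp,
    show -a * q / (a / b * -(s * q ^ j)) = b * q / (s * q ^ j) by field_simp,
    show -a * q / (s * q ^ j * -(s * q ^ j)) = q / (b * q ^ (j + 1) * q ^ j) by
      rw [show s * q ^ j * -(s * q ^ j) = -(s ^ 2 * q ^ j * q ^ j) by ring, ← hs2]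
      field_simp
      ring,
    show -a * q / (a / b) = -b * q by field_simp,
    show -a * q / (s * q ^ j) = -(a * q / (s * q ^ j)) by ring,
    show -a * q / -(s * q ^ j) = a * q / (s * q ^ j) by rw [div_neg]; ring,
    show -a * q / (a / b * (s * q ^ j) * -(s * q ^ j)) = q / (a * q ^ (j + 1) * q ^ j) by
      rw [show a / b * (s * q ^ j) * -(s * q ^ j) = -(a / b * s ^ 2 * q ^ j * q ^ j) by ring, ← hs2]
      field_simp
      ring,
    show a ^ 2 * q ^ 2 = (a * q) ^ 2 by ring, show b ^ 2 * q ^ 2 = (b * q) ^ 2 by ring,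
    ellFac_sq (a * q) _ hp, ellFac_sq (b * q) _ hp, two_mul, ellFac_add, ellFac_add,
    show b * q * q ^ j = b * q ^ (j + 1) by ring, show a * q * q ^ j = a * q ^ (j + 1) by ring,
    ← neg_mul b, ← neg_mul a, show a * b * q / a ^ 2 = b * q / a by field_simp]
  rw [show a * b * q / a ^ 2 = b * q / a by field_simp] at hKA
  have n1 := mul_inv_cancel₀ hKA
  have n3 := mul_inv_cancel₀ (hs.ellFac_left_mul_ne_zero hq j)
  have n4 := mul_inv_cancel₀ (ellFac_ne_zero_of_zpow (x := -a * q) (fun m => by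
    rw [mul_assoc, ← zpow_one_add₀ hq]
    exact h.neg_left _) j)
  have hX : (a ^ 2 / (a * b * q)) ^ j * (b ^ 2 / a ^ 2) ^ j * (a / b) ^ j = 1 / q ^ j := by
    rw [← mul_pow, ← mul_pow, ← one_div_pow]
    congr 1
    field_simp
  rw [← hX]
  generalize (a ^ 2 / (a * b * q)) ^ j = X1 at *
  generalize (b ^ 2 / a ^ 2) ^ j = X2 at *
  generalize (a / b) ^ j = X3 at *
  generalize ellFac (b * q / a) (q ^ 2) (p ^ 2) j = t1 at *
  generalize ellFac (a * q) q p j = t2 at *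
  generalize ellFac (b * q) q p j = t3 at *
  generalize ellFac (-a * q) q p j = t4 at *
  trans X1 * (ellFac (a * b * q) (q ^ 2) (p ^ 2) j * t1
      / (ellFac (q ^ 2) (q ^ 2) (p ^ 2) j * t2 * ellFac (-b * q) q p j)) * (t4 * t4⁻¹)
    * (ellFac (b * q / (s * q ^ j)) q p j * ellFac (-(b * q / (s * q ^ j))) q p j
      / (ellFac (a * q / (s * q ^ j)) q p j * ellFac (-(a * q / (s * q ^ j))) q p j))
    * (ellFac (q / (b * q ^ (j + 1) * q ^ j)) q p j / ellFac (q / (a * q ^ (j + 1) * q ^ j)) q p j)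
  · ring
  rw [r1, r2, n4]
  trans X1 * (ellFac (a * b * q) (q ^ 2) (p ^ 2) j * (t1 * t1⁻¹)
      / (ellFac (q ^ 2) (q ^ 2) (p ^ 2) j * t2 * ellFac (-b * q) q p j)) * (t3 * t3⁻¹)
    * (X2 * ellFac (a * q / b) (q ^ 2) (p ^ 2) j)
    * (X3 * (ellFac (b * q ^ (j + 1)) q p j / ellFac (a * q ^ (j + 1)) q p j))
  · rw [n3]
    ring
  · rw [n1]
    ring

/-! ### The transformation for parameters in general position -/

/-- The part of the `k`-th summand on the right-hand side that does not depend on `n`. -/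
noncomputable def rightTerm (a b q p : ℂ) (k : ℕ) : ℂ :=
  ellTheta (-a * q ^ (2 * k)) p / ellTheta (-a) p
    * (ellFac (-a) q p k * ellFac (a / b) q p k / (ellFac q q p k * ellFac (-b * q) q p k))

/-- The part of the `j`-th summand on the left-hand side that does not depend on `n`. -/
noncomputable def leftTerm (a b q p : ℂ) (j : ℕ) : ℂ :=
  ellTheta (a * b * q ^ (4 * j + 1)) (p ^ 2) / ellTheta (a * b * q) (p ^ 2)
    * (ellFac (a * b * q) (q ^ 2) (p ^ 2) j * ellFac (a * q / b) (q ^ 2) (p ^ 2) j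
      / (ellFac (q ^ 2) (q ^ 2) (p ^ 2) j * ellFac (b ^ 2 * q ^ 2) (q ^ 2) (p ^ 2) j))
    * (ellFac (-a * q) q p (2 * j) * ellFac (b * q) q p (2 * j)
      / (ellFac (-b * q) q p (2 * j) * ellFac (a * q) q p (2 * j)))

/-- The expansion of `leftTerm` in terms of `rightTerm`; it is `sum_baileyKernel_mul_ellFac` in the
normalization that fits `baileyKernelInv`. -/
theorem leftTerm_eq_sum {a b q p : ℂ} {j : ℕ} (hp : ‖p‖ < 1) (hq : q ≠ 0)
    (ha : a ≠ 0) (hb : b ≠ 0) (h : ThetaGeneric a b q p)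
    (hQ : ∀ i < j, ellTheta (q ^ (i + 1)) p ≠ 0) (hQ' : ∀ i < j, ellTheta (-q ^ (i + 1)) p ≠ 0) :
    1 / q ^ j * leftTerm a b q p j
        * (ellFac (-b) q p (2 * j + 1) / ellFac (-a) q p (2 * j + 1))
      = ∑ l ∈ Finset.range (j + 1), baileyKernelInv (a * b * q) (a ^ 2) (q ^ 2) (p ^ 2) j l
        * (ellTheta (-b) p * ellTheta a p * (1 / q ^ l * rightTerm a b q p l)
          / ellTheta (a ^ 2 * q ^ (4 * l)) (p ^ 2)) := by
  have key := sum_baileyKernel_mul_ellFac hp hq ha hb h hQ hQ'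
  have n1 : ellTheta a p ≠ 0 := by simpa using h.left 0
  have hterm : ∀ l ∈ Finset.range (j + 1),
      baileyKernelInv (a * b * q) (a ^ 2) (q ^ 2) (p ^ 2) j l
        * (ellTheta (-b) p * ellTheta a p * (1 / q ^ l * rightTerm a b q p l)
          / ellTheta (a ^ 2 * q ^ (4 * l)) (p ^ 2))
      = ellTheta (a * b * q ^ (4 * j + 1)) (p ^ 2) / ellTheta (a * b * q) (p ^ 2)
        * (ellTheta (-b) p / ellTheta (-a) p)
        * (baileyKernel (a ^ 2) (a * b * q) (q ^ 2) (p ^ 2) j l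
        * (a ^ 2 / (a * b * q)) ^ (j - l) * (1 / q ^ l * (ellTheta (-a * q ^ (2 * l)) p
          / ellTheta (-a) p * (ellFac (-a) q p l * ellFac (a / b) q p l
            / (ellFac q q p l * ellFac (-b * q) q p l))))) := by
    intro l _
    have n3 : ellTheta (a ^ 2 * q ^ (4 * l)) (p ^ 2) ≠ 0 := by
      rw [show a ^ 2 * q ^ (4 * l) = (a * q ^ (2 * l)) ^ 2 by ring, ellTheta_sq _ hp, ← neg_mul]
      have h1 := h.left (2 * l : ℕ)
      have h2 := h.neg_left (2 * l : ℕ)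
      rw [zpow_natCast] at h1 h2
      exact mul_ne_zero h1 h2
    rw [baileyKernelInv, ellTheta_sq a hp, ← rightTerm,
      show a * b * q * (q ^ 2) ^ (2 * j) = a * b * q ^ (4 * j + 1) by ring,
      show a ^ 2 * (q ^ 2) ^ (2 * l) = a ^ 2 * q ^ (4 * l) by ring]
    generalize ellTheta (a ^ 2 * q ^ (4 * l)) (p ^ 2) = t3 at *
    generalize ellTheta a p = t1 at *
    generalize rightTerm a b q p l = R
    generalize (a ^ 2 / (a * b * q)) ^ (j - l) = S
    generalize 1 / q ^ l = Q
    have h1 := mul_inv_cancel₀ n1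
    have h3 := mul_inv_cancel₀ n3
    have h6 : ∀ M : ℂ, M * (t1 * t1⁻¹) * (t3 * t3⁻¹) = M := fun M => by
      rw [h1, h3, mul_one, mul_one]
    refine Eq.trans ?_ (h6 _)
    ring
  rw [Finset.sum_congr rfl hterm, ← Finset.mul_sum, key, leftTerm, ellFac_succ', ellFac_succ']
  have n3 := mul_inv_cancel₀ (ellFac_ne_zero_of_zpow (x := -a * q) (fun m => by
    rw [mul_assoc, ← zpow_one_add₀ hq]
    exact h.neg_left _) (2 * j))
  have n4 := mul_inv_cancel₀ (ellFac_ne_zero_of_zpow (x := -b * q) (fun m => by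
    rw [mul_assoc, ← zpow_one_add₀ hq]
    exact h.neg_right _) (2 * j))
  generalize ellFac (-a * q) q p (2 * j) = U at *
  generalize ellFac (-b * q) q p (2 * j) = V at *
  have h6 : ∀ M : ℂ, M = M * (U * U⁻¹) * (V * V⁻¹) := fun M => by
    rw [n3, n4, mul_one, mul_one]
  refine Eq.trans ?_ (h6 _).symm
  ring

/-- The inversion of `leftTerm_eq_sum`: suitably normalized, the two sequences form a Bailey
pair. -/
theorem rightTerm_eq_sum {a b q p : ℂ} {k : ℕ} (hp : ‖p‖ < 1) (hq : q ≠ 0)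
    (ha : a ≠ 0) (hb : b ≠ 0) (h : ThetaGeneric a b q p)
    (hQ : ∀ i < k, ellTheta (q ^ (i + 1)) p ≠ 0) (hQ' : ∀ i < k, ellTheta (-q ^ (i + 1)) p ≠ 0) :
    ellTheta (-b) p * ellTheta a p * (1 / q ^ k * rightTerm a b q p k)
      = ellTheta (a ^ 2 * q ^ (4 * k)) (p ^ 2) * ∑ j ∈ Finset.range (k + 1),
        baileyKernel (a * b * q) (a ^ 2) (q ^ 2) (p ^ 2) k j
          * (1 / q ^ j * leftTerm a b q p j
            * (ellFac (-b) q p (2 * j + 1) / ellFac (-a) q p (2 * j + 1))) := by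
  have hp2 := norm_sq_lt_one hp
  have hs := h.swap hp hq ha hb
  have hsum : ∀ j ∈ Finset.range (k + 1),
      baileyKernel (a * b * q) (a ^ 2) (q ^ 2) (p ^ 2) k j
          * (1 / q ^ j * leftTerm a b q p j
            * (ellFac (-b) q p (2 * j + 1) / ellFac (-a) q p (2 * j + 1)))
      = ∑ l ∈ Finset.range (j + 1), baileyKernel (a * b * q) (a ^ 2) (q ^ 2) (p ^ 2) k j
          * baileyKernelInv (a * b * q) (a ^ 2) (q ^ 2) (p ^ 2) j l
        * (ellTheta (-b) p * ellTheta a p * (1 / q ^ l * rightTerm a b q p l)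
          / ellTheta (a ^ 2 * q ^ (4 * l)) (p ^ 2)) := by
    intro j hj
    have hj := Nat.lt_succ_iff.1 (Finset.mem_range.1 hj)
    rw [leftTerm_eq_sum hp hq ha hb h (fun i hi => hQ i (by omega)) (fun i hi => hQ' i (by omega)),
      Finset.mul_sum]
    exact Finset.sum_congr rfl fun l _ => (mul_assoc _ _ _).symm
  rw [Finset.sum_congr rfl hsum, sum_range_sum_range_succ k (fun j l =>
    baileyKernel (a * b * q) (a ^ 2) (q ^ 2) (p ^ 2) k j
          * baileyKernelInv (a * b * q) (a ^ 2) (q ^ 2) (p ^ 2) j l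
        * (ellTheta (-b) p * ellTheta a p * (1 / q ^ l * rightTerm a b q p l)
          / ellTheta (a ^ 2 * q ^ (4 * l)) (p ^ 2)))]
  have hsq : ∀ m : ℤ, ellTheta (a ^ 2 * (q ^ 2) ^ m) (p ^ 2) ≠ 0 := by
    intro m
    rw [← zpow_natCast q 2, ← zpow_mul, mul_comm _ m, zpow_mul, zpow_natCast, ← mul_pow,
      ellTheta_sq _ hp, ← neg_mul]
    exact mul_ne_zero (h.left m) (h.neg_left m)
  have hz : ∀ m : ℤ, q * (q ^ 2) ^ m = q ^ (1 + 2 * m) := fun m => by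
    rw [zpow_add₀ hq, zpow_mul, zpow_one]
    norm_cast
  rw [Finset.sum_range_succ, Finset.sum_eq_zero, zero_add]
  · have h1 := sum_baileyKernel_mul_inv (A := a * b * q) (K := a ^ 2) (q := q ^ 2) (p := p ^ 2) hp2
      (pow_ne_zero 2 hq) (mul_ne_zero (mul_ne_zero ha hb) hq) (pow_ne_zero 2 ha)
      (fun m => by rw [mul_assoc, hz]; exact h.mul _) hsq
      (fun m => by
        rw [show a * b * q / a ^ 2 * (q ^ 2) ^ m = b / a * (q * (q ^ 2) ^ m) by field_simp, hz]
        exact ellTheta_sq_nome_ne_zero hp (hs.div _)) k (m := 0) (by omega)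
    rw [← Finset.sum_mul, Nat.sub_self]
    rw [if_pos rfl, add_zero] at h1
    rw [h1, one_mul, mul_div_cancel₀]
    have := hsq (2 * k : ℕ)
    rwa [zpow_natCast, ← pow_mul, show 2 * (2 * k) = 4 * k by ring] at this
  · intro l hl
    have hl := Finset.mem_range.1 hl
    obtain ⟨m, rfl⟩ := Nat.exists_eq_add_of_le hl.le
    rw [← Finset.sum_mul, Nat.add_sub_cancel_left, sum_baileyKernel_mul_inv hp2
      (pow_ne_zero 2 hq) (mul_ne_zero (mul_ne_zero ha hb) hq) (pow_ne_zero 2 ha)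
      (fun m => by rw [mul_assoc, hz]; exact h.mul _) hsq
      (fun m => by
        rw [show a * b * q / a ^ 2 * (q ^ 2) ^ m = b / a * (q * (q ^ 2) ^ m) by field_simp, hz]
        exact ellTheta_sq_nome_ne_zero hp (hs.div _)) l, if_neg (by omega), zero_mul]
    intro j hj
    rw [← pow_mul, mul_comm 2, pow_mul, ellTheta_sq _ hp]
    exact mul_ne_zero (hQ j (by omega)) (hQ' j (by omega))

/-- The transformation in terms of kernels: `rightTerm_eq_sum` is inserted on the right, and after
an interchange of summations the inner sum is `sum_baileyKernel_mul_baileyKernel`. -/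
theorem sum_leftTerm_eq_sum_rightTerm {a b q p : ℂ} {n : ℕ} (hp : ‖p‖ < 1) (hq : q ≠ 0)
    (ha : a ≠ 0) (hb : b ≠ 0) (h : ThetaGeneric a b q p)
    (hQ : ∀ i < n, ellTheta (q ^ (i + 1)) p ≠ 0) (hQ' : ∀ i < n, ellTheta (-q ^ (i + 1)) p ≠ 0) :
    ellTheta (-(b * q ^ (2 * n))) p * q ^ n * ∑ j ∈ Finset.range (n + 1),
        baileyKernel (a * b * q) (b ^ 2) (q ^ 2) (p ^ 2) n j * (b / (a * q)) ^ j
          * leftTerm a b q p j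
      = ellTheta (-b) p * ∑ k ∈ Finset.range (n + 1),
        baileyKernel a b q p n k * (b / a) ^ k * rightTerm a b q p k := by
  have n1 : ellTheta a p ≠ 0 := by simpa using h.left 0
  refine mul_left_cancel₀ n1 ?_
  have hR : ∀ k ∈ Finset.range (n + 1),
      ellTheta a p * (ellTheta (-b) p
        * (baileyKernel a b q p n k * (b / a) ^ k * rightTerm a b q p k))
      = ∑ j ∈ Finset.range (k + 1), baileyKernel a b q p n k * (b * q / a) ^ k
        * ellTheta (a ^ 2 * q ^ (4 * k)) (p ^ 2)
        * baileyKernel (a * b * q) (a ^ 2) (q ^ 2) (p ^ 2) k j * (1 / q ^ j * leftTerm a b q p j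
            * (ellFac (-b) q p (2 * j + 1) / ellFac (-a) q p (2 * j + 1))) := by
    intro k hk
    have hk := Nat.lt_succ_iff.1 (Finset.mem_range.1 hk)
    have h1 := rightTerm_eq_sum hp hq ha hb h (fun i hi => hQ i (by omega))
      (fun i hi => hQ' i (by omega)) (k := k)
    simp only [mul_assoc]
    simp only [← Finset.mul_sum]
    simp only [mul_assoc] at h1
    rw [← h1, mul_div_right_comm, mul_pow]
    field_simp
  simp only [Finset.mul_sum (Finset.range (n + 1))]
  rw [Finset.sum_congr rfl hR, sum_range_sum_range_succ n
    (fun k j => baileyKernel a b q p n k * (b * q / a) ^ k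
        * ellTheta (a ^ 2 * q ^ (4 * k)) (p ^ 2)
        * baileyKernel (a * b * q) (a ^ 2) (q ^ 2) (p ^ 2) k j * (1 / q ^ j * leftTerm a b q p j
            * (ellFac (-b) q p (2 * j + 1) / ellFac (-a) q p (2 * j + 1))))]
  refine Finset.sum_congr rfl fun j hj => ?_
  obtain ⟨m, rfl⟩ := Nat.exists_eq_add_of_le (Nat.lt_succ_iff.1 (Finset.mem_range.1 hj))
  rw [← Finset.sum_mul, Nat.add_sub_cancel_left, sum_baileyKernel_mul_baileyKernel j hp hq ha hb h
    (fun i hi => hQ i (by omega)) (fun i hi => hQ' i (by omega))]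
  have n3 := mul_inv_cancel₀ (ellFac_ne_zero_of_zpow h.neg_left (2 * j + 1))
  have n4 := mul_inv_cancel₀ (ellFac_ne_zero_of_zpow h.neg_right (2 * j + 1))
  generalize ellFac (-a) q p (2 * j + 1) = U at *
  generalize ellFac (-b) q p (2 * j + 1) = V at *
  have hX : (b / (a * q)) ^ j = (b / a) ^ j * (1 / q ^ j) := by
    rw [← one_div_pow, ← mul_pow]
    congr 1
    field_simp
  rw [hX]
  have h6 : ∀ M : ℂ, M = M * (U * U⁻¹) * (V * V⁻¹) := fun M => by
    rw [n3, n4, mul_one, mul_one]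
  refine (h6 _).trans ?_
  ring

/-- The left-hand side of the transformation. -/
noncomputable def leftSide (n : ℕ) (p q a b : ℂ) : ℂ :=
  ∑ j ∈ Finset.range (n + 1),
    (ellTheta (a * b * q ^ (4 * j + 1)) (p ^ 2)
        * (ellFac (b ^ 2 * q ^ (2 * n)) (q ^ 2) (p ^ 2) j
          * ellFac (q ^ (-2 * (n : ℤ))) (q ^ 2) (p ^ 2) j
          * ellFac (a * q / b) (q ^ 2) (p ^ 2) j
          * ellFac (a * b * q) (q ^ 2) (p ^ 2) j)
        * (ellFac (-a * q) q p (2 * j) * ellFac (b * q) q p (2 * j)))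
      / (ellTheta (a * b * q) (p ^ 2)
        * (ellFac (a * q ^ (3 - 2 * (n : ℤ)) / b) (q ^ 2) (p ^ 2) j
          * ellFac (a * b * q ^ (3 + 2 * n)) (q ^ 2) (p ^ 2) j
          * ellFac (b ^ 2 * q ^ 2) (q ^ 2) (p ^ 2) j
          * ellFac (q ^ 2) (q ^ 2) (p ^ 2) j)
        * (ellFac (-b * q) q p (2 * j) * ellFac (a * q) q p (2 * j)))
      * q ^ (2 * j)

/-- The right-hand side of the transformation. -/
noncomputable def rightSide (n : ℕ) (p q a b : ℂ) : ℂ :=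
  (ellTheta (-b) p
        * (ellFac (-q) q p n * ellFac (b / a) q p n)
        * ellFac (a * b * q ^ 3) (q ^ 2) (p ^ 2) n)
      / (ellTheta (-b * q ^ (2 * n)) p
        * (ellFac (-b) q p n * ellFac (a * q) q p n)
        * ellFac (b / (a * q)) (q ^ 2) (p ^ 2) n)
      * q ^ (-(n : ℤ))
    * ∑ k ∈ Finset.range (n + 1),
        (ellTheta (-a * q ^ (2 * k)) p
            * (ellFac (-a) q p k * ellFac (b * q ^ n) q p k
              * ellFac (q ^ (-(n : ℤ))) q p k * ellFac (a / b) q p k))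
          / (ellTheta (-a) p
            * (ellFac q q p k * ellFac (a * q ^ (1 - (n : ℤ)) / b) q p k
              * ellFac (a * q ^ (1 + n)) q p k * ellFac (-b * q) q p k))
          * q ^ k

theorem leftSide_eq_rightSide_of_generic {a b q p : ℂ} {n : ℕ} (hp : ‖p‖ < 1) (hq : q ≠ 0)
    (ha : a ≠ 0) (hb : b ≠ 0) (h : ThetaGeneric a b q p)
    (hQ : ∀ i < n, ellTheta (q ^ (i + 1)) p ≠ 0) (hQ' : ∀ i < n, ellTheta (-q ^ (i + 1)) p ≠ 0) :
    leftSide n p q a b = rightSide n p q a b := by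
  have hp2 := norm_sq_lt_one hp
  have hA : a * b * q ≠ 0 := mul_ne_zero (mul_ne_zero ha hb) hq
  have hq2 := pow_ne_zero 2 hq
  have hs := h.swap hp hq ha hb
  have key := sum_leftTerm_eq_sum_rightTerm hp hq ha hb h hQ hQ'
  have hq1 : ellFac q q p n ≠ 0 := ellFac_ne_zero fun i hi => by
    rw [← pow_succ']
    exact hQ i hi
  have hq1' : ellFac (-q) q p n ≠ 0 := ellFac_ne_zero fun i hi => by
    rw [neg_mul, ← pow_succ']
    exact hQ' i hi
  have hQ2 : ellFac (q ^ 2) (q ^ 2) (p ^ 2) n ≠ 0 := by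
    rw [ellFac_sq _ _ hp]
    exact mul_ne_zero hq1 hq1'
  have hKA : ellFac (b ^ 2 / (a * b * q)) (q ^ 2) (p ^ 2) n ≠ 0 := ellFac_ne_zero fun i _ => by
    rw [show b ^ 2 / (a * b * q) * (q ^ 2) ^ i = b / a * q ^ (((2 * i : ℕ) : ℤ) - 1) by
      rw [zpow_sub₀ hq, zpow_natCast, pow_mul, zpow_one]
      field_simp]
    exact ellTheta_sq_nome_ne_zero hp (hs.div _)
  have hba : ellFac (b / a) q p n ≠ 0 := ellFac_ne_zero_of_zpow hs.div n
  have hl : ∀ j ∈ Finset.range (n + 1),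
      baileyKernel (a * b * q) (b ^ 2) (q ^ 2) (p ^ 2) n j * (b / (a * q)) ^ j * leftTerm a b q p j
      = ellFac (b ^ 2) (q ^ 2) (p ^ 2) n * ellFac (b / (a * q)) (q ^ 2) (p ^ 2) n
        / (ellFac (q ^ 2) (q ^ 2) (p ^ 2) n * ellFac (a * b * q ^ 3) (q ^ 2) (p ^ 2) n)
        * ((ellTheta (a * b * q ^ (4 * j + 1)) (p ^ 2)
        * (ellFac (b ^ 2 * q ^ (2 * n)) (q ^ 2) (p ^ 2) j
          * ellFac (q ^ (-2 * (n : ℤ))) (q ^ 2) (p ^ 2) j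
          * ellFac (a * q / b) (q ^ 2) (p ^ 2) j
          * ellFac (a * b * q) (q ^ 2) (p ^ 2) j)
        * (ellFac (-a * q) q p (2 * j) * ellFac (b * q) q p (2 * j)))
      / (ellTheta (a * b * q) (p ^ 2)
        * (ellFac (a * q ^ (3 - 2 * (n : ℤ)) / b) (q ^ 2) (p ^ 2) j
          * ellFac (a * b * q ^ (3 + 2 * n)) (q ^ 2) (p ^ 2) j
          * ellFac (b ^ 2 * q ^ 2) (q ^ 2) (p ^ 2) j
          * ellFac (q ^ 2) (q ^ 2) (p ^ 2) j)
        * (ellFac (-b * q) q p (2 * j) * ellFac (a * q) q p (2 * j)))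
      * q ^ (2 * j)) := by
    intro j hj
    have hX : (a * b * q * q ^ 2 / b ^ 2) ^ j * (b / (a * q)) ^ j = q ^ (2 * j) := by
      rw [← mul_pow, pow_mul]
      congr 1
      field_simp
    rw [baileyKernel_eq hp2 hA (pow_ne_zero 2 hb) hq2 (Nat.lt_succ_iff.1 (Finset.mem_range.1 hj))
      hKA hQ2, leftTerm, show b ^ 2 / (a * b * q) = b / (a * q) by field_simp,
      show a * b * q * q ^ 2 * (q ^ 2) ^ n = a * b * q ^ (3 + 2 * n) by ring,
      show a * b * q * q ^ 2 / (b ^ 2 * (q ^ 2) ^ n) = a * q ^ (3 - 2 * (n : ℤ)) / b by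
        rw [zpow_sub₀ hq, zpow_mul]
        norm_cast
        field_simp,
      show 1 / (q ^ 2) ^ n = q ^ (-2 * (n : ℤ)) by
        rw [neg_mul, zpow_neg, zpow_mul, one_div]
        norm_cast,
      show b ^ 2 * (q ^ 2) ^ n = b ^ 2 * q ^ (2 * n) by rw [pow_mul],
      show a * b * q * q ^ 2 = a * b * q ^ 3 by ring]
    rw [show a * b * q * q ^ 2 = a * b * q ^ 3 by ring] at hX
    rw [← hX]
    ring
  have hr : ∀ k ∈ Finset.range (n + 1), baileyKernel a b q p n k * (b / a) ^ k * rightTerm a b q p k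
      = ellFac b q p n * ellFac (b / a) q p n / (ellFac q q p n * ellFac (a * q) q p n)
        * ((ellTheta (-a * q ^ (2 * k)) p
            * (ellFac (-a) q p k * ellFac (b * q ^ n) q p k
              * ellFac (q ^ (-(n : ℤ))) q p k * ellFac (a / b) q p k))
          / (ellTheta (-a) p
            * (ellFac q q p k * ellFac (a * q ^ (1 - (n : ℤ)) / b) q p k
              * ellFac (a * q ^ (1 + n)) q p k * ellFac (-b * q) q p k))
          * q ^ k) := by
    intro k hk
    have hX : (a * q / b) ^ k * (b / a) ^ k = q ^ k := by
      rw [← mul_pow]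
      congr 1
      field_simp
    rw [baileyKernel_eq hp ha hb hq (Nat.lt_succ_iff.1 (Finset.mem_range.1 hk)) hba hq1, rightTerm,
      show a * q * q ^ n = a * q ^ (1 + n) by ring,
      show a * q / (b * q ^ n) = a * q ^ (1 - (n : ℤ)) / b by
        rw [zpow_sub₀ hq, zpow_one, zpow_natCast]
        field_simp,
      show 1 / q ^ n = q ^ (-(n : ℤ)) by rw [zpow_neg, zpow_natCast, one_div], ← hX]
    ring
  rw [Finset.sum_congr rfl hl, Finset.sum_congr rfl hr, ← Finset.mul_sum, ← Finset.mul_sum,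
    ← leftSide, ← neg_mul] at key
  unfold rightSide
  generalize (∑ k ∈ Finset.range (n + 1), _ : ℂ) = R at *
  generalize leftSide n p q a b = L at *
  rw [ellFac_sq b _ hp, ellFac_sq q _ hp] at key
  rw [show b ^ 2 / (a * b * q) = b / (a * q) by field_simp] at hKA
  have h1 := ellFac_ne_zero_of_zpow h.right n
  have h2 := ellFac_ne_zero_of_zpow h.neg_right n
  have h3 := h.ellFac_left_mul_ne_zero hq n
  have h4 : ellFac (a * b * q ^ 3) (q ^ 2) (p ^ 2) n ≠ 0 := ellFac_ne_zero fun i _ => by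
    rw [show a * b * q ^ 3 * (q ^ 2) ^ i = a * b * q ^ ((3 + 2 * i : ℕ) : ℤ) by
      rw [zpow_natCast, pow_add, pow_mul, mul_assoc]]
    exact h.mul _
  have h5 : ellTheta (-b * q ^ (2 * n)) p ≠ 0 := by
    have := h.neg_right (2 * n : ℕ)
    rwa [zpow_natCast] at this
  rw [zpow_neg, zpow_natCast]
  generalize ellFac b q p n = x1 at *
  generalize ellFac (-b) q p n = x2 at *
  generalize ellFac (a * q) q p n = x3 at *
  generalize ellFac (a * b * q ^ 3) (q ^ 2) (p ^ 2) n = x4 at *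
  generalize ellTheta (-b * q ^ (2 * n)) p = x5 at *
  generalize ellFac q q p n = x6 at *
  generalize ellFac (-q) q p n = x7 at *
  generalize ellFac (b / a) q p n = x8 at *
  generalize ellFac (b / (a * q)) (q ^ 2) (p ^ 2) n = x9 at *
  have hqn := pow_ne_zero n hq
  clear hl hr hQ hQ'
  field_simp at key ⊢
  linear_combination key

/-! ### Removing the genericity assumption -/

theorem ellFac_ne_zero_of_le {x q p : ℂ} {j n : ℕ} (hj : j ≤ n) (h : ellFac x q p n ≠ 0) :
    ellFac x q p j ≠ 0 := by
  obtain ⟨m, rfl⟩ := Nat.exists_eq_add_of_le hj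
  rw [ellFac_add] at h
  exact left_ne_zero_of_mul h

theorem countable_ellTheta_mul_pow {p c : ℂ} (hp : ‖p‖ < 1) (hc : c ≠ 0) {e : ℕ} (he : 0 < e) :
    {x : ℂ | ellTheta (c * x ^ e) p = 0}.Countable := by
  have h : {x : ℂ | ellTheta (c * x ^ e) p = 0}
      = ⋃ y ∈ {y : ℂ | ellTheta y p = 0}, {x : ℂ | c * x ^ e = y} := by
    ext x
    simp
  rw [h]
  refine (countable_ellTheta_zeros hp).biUnion fun y _ => Set.Finite.countable ?_
  refine (Polynomial.nthRoots e (y / c)).toFinset.finite_toSet.subset fun x hx => ?_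
  have hx : c * x ^ e = y := hx
  rw [Finset.mem_coe, Multiset.mem_toFinset, Polynomial.mem_nthRoots he]
  exact eq_div_of_mul_eq hc (by rw [mul_comm, hx])

/-- Genericity holds for points arbitrarily close to given parameters, along the curve
`(ax², bx)`. The exponents are such that `ab` and `a/b` vary as well. -/
theorem frequently_thetaGeneric {a b q p : ℂ} (hp : ‖p‖ < 1) (hq : q ≠ 0) (ha : a ≠ 0)
    (hb : b ≠ 0) : ∃ᶠ x in 𝓝 (1 : ℂ), x ≠ 0 ∧ ThetaGeneric (a * x ^ 2) (b * x) q p := by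
  have hc : ∀ {p c : ℂ} (_ : ‖p‖ < 1) (_ : c ≠ 0) {e : ℕ} (_ : 0 < e),
      (⋃ m : ℤ, {x : ℂ | ellTheta (c * q ^ m * x ^ e) p = 0}).Countable := fun hp hc _ he =>
    Set.countable_iUnion fun m =>
      countable_ellTheta_mul_pow hp (mul_ne_zero hc (zpow_ne_zero m hq)) he
  have hd := ((Set.countable_singleton (0 : ℂ)).union ((hc hp ha two_pos).union
    ((hc hp (neg_ne_zero.2 ha) two_pos).union ((hc hp hb one_pos).union
    ((hc hp (neg_ne_zero.2 hb) one_pos).union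
    ((hc (norm_sq_lt_one hp) (mul_ne_zero ha hb) three_pos).union
    (hc hp (div_ne_zero ha hb) one_pos))))))).dense_compl ℝ
  refine (mem_closure_iff_frequently.1 (hd 1)).mono fun x hx => ?_
  simp only [Set.mem_compl_iff, Set.mem_union, Set.mem_singleton_iff, Set.mem_iUnion,
    Set.mem_ofPred_eq, not_or, not_exists, pow_one] at hx
  obtain ⟨h0, h1, h2, h3, h4, h5, h6⟩ := hx
  refine ⟨h0, fun m => ?_, fun m => ?_, fun m => ?_, fun m => ?_, fun m => ?_, fun m => ?_⟩
  · rw [mul_right_comm]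
    exact h1 m
  · rw [← neg_mul, mul_right_comm]
    exact h2 m
  · rw [mul_right_comm]
    exact h3 m
  · rw [← neg_mul, mul_right_comm]
    exact h4 m
  · rw [show a * x ^ 2 * (b * x) * q ^ m = a * b * q ^ m * x ^ 3 by ring]
    exact h5 m
  · rw [show a * x ^ 2 / (b * x) * q ^ m = a / b * q ^ m * x by field_simp]
    exact h6 m

theorem continuousAt_leftSide {n : ℕ} {p q a b : ℂ} (hp : ‖p‖ < 1)
    (hq : q ≠ 0) (ha : a ≠ 0) (hb : b ≠ 0)
    (hL1 : ellTheta (a * b * q) (p ^ 2) ≠ 0)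
    (hL2 : ellFac (a * q ^ (3 - 2 * (n : ℤ)) / b) (q ^ 2) (p ^ 2) n ≠ 0)
    (hL3 : ellFac (a * b * q ^ (3 + 2 * n)) (q ^ 2) (p ^ 2) n ≠ 0)
    (hL4 : ellFac (b ^ 2 * q ^ 2) (q ^ 2) (p ^ 2) n ≠ 0)
    (hL5 : ellFac (q ^ 2) (q ^ 2) (p ^ 2) n ≠ 0)
    (hL6 : ellFac (-b * q) q p (2 * n) ≠ 0)
    (hL7 : ellFac (a * q) q p (2 * n) ≠ 0) :
    ContinuousAt (fun y : ℂ × ℂ => leftSide n p q y.1 y.2) (a, b) := by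
  have hp2 := norm_sq_lt_one hp
  have hq2 := pow_ne_zero 2 hq
  have ca : ContinuousAt (fun y : ℂ × ℂ => y.1) (a, b) := continuousAt_fst
  have cb : ContinuousAt (fun y : ℂ × ℂ => y.2) (a, b) := continuousAt_snd
  have cc : ∀ z : ℂ, ContinuousAt (fun _ : ℂ × ℂ => z) (a, b) := fun z => continuousAt_const
  have hqz := fun m : ℤ => zpow_ne_zero m hq
  unfold leftSide
  refine tendsto_finsetSum _ fun j hj => ?_
  have hj := Nat.lt_succ_iff.1 (Finset.mem_range.1 hj)
  refine ContinuousAt.mul (ContinuousAt.div ?_ ?_ ?_) (cc _)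
  · refine ((ContinuousAt.ellTheta hp2 ((ca.mul cb).mul (cc _)) ?_).mul
      ((((ContinuousAt.ellFac hp2 hq2 ((cb.pow 2).mul (cc _)) ?_ _).mul (cc _)).mul
        (ContinuousAt.ellFac hp2 hq2 ((ca.mul (cc _)).div cb hb) ?_ _)).mul
        (ContinuousAt.ellFac hp2 hq2 ((ca.mul cb).mul (cc _)) ?_ _))).mul
      ((ContinuousAt.ellFac hp hq (ca.neg.mul (cc _)) ?_ _).mul
        (ContinuousAt.ellFac hp hq (cb.mul (cc _)) ?_ _))
    all_goals simp [ha, hb, hq]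
  · refine ((ContinuousAt.ellTheta hp2 ((ca.mul cb).mul (cc _)) ?_).mul
      ((((ContinuousAt.ellFac hp2 hq2 ((ca.mul (cc _)).div cb hb) ?_ _).mul
        (ContinuousAt.ellFac hp2 hq2 ((ca.mul cb).mul (cc _)) ?_ _)).mul
        (ContinuousAt.ellFac hp2 hq2 ((cb.pow 2).mul (cc _)) ?_ _)).mul (cc _))).mul
      ((ContinuousAt.ellFac hp hq (cb.neg.mul (cc _)) ?_ _).mul
        (ContinuousAt.ellFac hp hq (ca.mul (cc _)) ?_ _))
    all_goals simp [ha, hb, hq, hqz]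
  · exact mul_ne_zero (mul_ne_zero hL1 (mul_ne_zero (mul_ne_zero (mul_ne_zero
      (ellFac_ne_zero_of_le hj hL2) (ellFac_ne_zero_of_le hj hL3)) (ellFac_ne_zero_of_le hj hL4))
      (ellFac_ne_zero_of_le hj hL5))) (mul_ne_zero (ellFac_ne_zero_of_le (by omega) hL6)
      (ellFac_ne_zero_of_le (by omega) hL7))

theorem continuousAt_rightSide {n : ℕ} {p q a b : ℂ} (hp : ‖p‖ < 1)
    (hq : q ≠ 0) (ha : a ≠ 0) (hb : b ≠ 0)
    (hP1 : ellTheta (-b * q ^ (2 * n)) p ≠ 0)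
    (hP2 : ellFac (-b) q p n ≠ 0)
    (hP3 : ellFac (a * q) q p n ≠ 0)
    (hP4 : ellFac (b / (a * q)) (q ^ 2) (p ^ 2) n ≠ 0)
    (hR1 : ellTheta (-a) p ≠ 0)
    (hR2 : ellFac q q p n ≠ 0)
    (hR3 : ellFac (a * q ^ (1 - (n : ℤ)) / b) q p n ≠ 0)
    (hR4 : ellFac (a * q ^ (1 + n)) q p n ≠ 0)
    (hR5 : ellFac (-b * q) q p n ≠ 0) :
    ContinuousAt (fun y : ℂ × ℂ => rightSide n p q y.1 y.2) (a, b) := by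
  have hp2 := norm_sq_lt_one hp
  have hq2 := pow_ne_zero 2 hq
  have ca : ContinuousAt (fun y : ℂ × ℂ => y.1) (a, b) := continuousAt_fst
  have cb : ContinuousAt (fun y : ℂ × ℂ => y.2) (a, b) := continuousAt_snd
  have cc : ∀ z : ℂ, ContinuousAt (fun _ : ℂ × ℂ => z) (a, b) := fun z => continuousAt_const
  have hqz := fun m : ℤ => zpow_ne_zero m hq
  unfold rightSide
  refine ContinuousAt.mul (ContinuousAt.mul (ContinuousAt.div ?_ ?_ ?_) (cc _)) ?_
  · refine ((ContinuousAt.ellTheta hp cb.neg ?_).mul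
      ((cc _).mul (ContinuousAt.ellFac hp hq (cb.div ca ha) ?_ _))).mul
      (ContinuousAt.ellFac hp2 hq2 ((ca.mul cb).mul (cc _)) ?_ _)
    all_goals simp [ha, hb, hq]
  · refine ((ContinuousAt.ellTheta hp (cb.neg.mul (cc _)) ?_).mul
      ((ContinuousAt.ellFac hp hq cb.neg ?_ _).mul
        (ContinuousAt.ellFac hp hq (ca.mul (cc _)) ?_ _))).mul
      (ContinuousAt.ellFac hp2 hq2 (cb.div (ca.mul (cc _)) ?_) ?_ _)
    all_goals simp [ha, hb, hq]
  · exact mul_ne_zero (mul_ne_zero hP1 (mul_ne_zero hP2 hP3)) hP4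
  refine tendsto_finsetSum _ fun k hk => ?_
  have hk := Nat.lt_succ_iff.1 (Finset.mem_range.1 hk)
  refine ContinuousAt.mul (ContinuousAt.div ?_ ?_ ?_) (cc _)
  · refine (ContinuousAt.ellTheta hp (ca.neg.mul (cc _)) ?_).mul
      ((((ContinuousAt.ellFac hp hq ca.neg ?_ _).mul
        (ContinuousAt.ellFac hp hq (cb.mul (cc _)) ?_ _)).mul (cc _)).mul
        (ContinuousAt.ellFac hp hq (ca.div cb hb) ?_ _))
    all_goals simp [ha, hb, hq]
  · refine (ContinuousAt.ellTheta hp ca.neg ?_).mul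
      ((((cc _).mul (ContinuousAt.ellFac hp hq ((ca.mul (cc _)).div cb hb) ?_ _)).mul
        (ContinuousAt.ellFac hp hq (ca.mul (cc _)) ?_ _)).mul
        (ContinuousAt.ellFac hp hq (cb.neg.mul (cc _)) ?_ _))
    all_goals simp [ha, hb, hq, hqz]
  · exact mul_ne_zero hR1 (mul_ne_zero (mul_ne_zero (mul_ne_zero (ellFac_ne_zero_of_le hk hR2)
      (ellFac_ne_zero_of_le hk hR3)) (ellFac_ne_zero_of_le hk hR4)) (ellFac_ne_zero_of_le hk hR5))

theorem mainTheorem6 (n : ℕ) (p q a b : ℂ) (hp : ‖p‖ < 1)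
    (hq : q ≠ 0) (ha : a ≠ 0) (hb : b ≠ 0)
    -- no denominator on the left-hand side vanishes
    -- (every factor `(x)_j` with `j ≤ n` divides `(x)_n`)
    (hL1 : ellTheta (a * b * q) (p ^ 2) ≠ 0)
    (hL2 : ellFac (a * q ^ (3 - 2 * (n : ℤ)) / b) (q ^ 2) (p ^ 2) n ≠ 0)
    (hL3 : ellFac (a * b * q ^ (3 + 2 * n)) (q ^ 2) (p ^ 2) n ≠ 0)
    (hL4 : ellFac (b ^ 2 * q ^ 2) (q ^ 2) (p ^ 2) n ≠ 0)
    (hL5 : ellFac (q ^ 2) (q ^ 2) (p ^ 2) n ≠ 0)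
    (hL6 : ellFac (-b * q) q p (2 * n) ≠ 0)
    (hL7 : ellFac (a * q) q p (2 * n) ≠ 0)
    -- no denominator on the right-hand side vanishes
    (hP1 : ellTheta (-b * q ^ (2 * n)) p ≠ 0)
    (hP2 : ellFac (-b) q p n ≠ 0)
    (hP3 : ellFac (a * q) q p n ≠ 0)
    (hP4 : ellFac (b / (a * q)) (q ^ 2) (p ^ 2) n ≠ 0)
    (hR1 : ellTheta (-a) p ≠ 0)
    (hR2 : ellFac q q p n ≠ 0)
    (hR3 : ellFac (a * q ^ (1 - (n : ℤ)) / b) q p n ≠ 0)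
    (hR4 : ellFac (a * q ^ (1 + n)) q p n ≠ 0)
    (hR5 : ellFac (-b * q) q p n ≠ 0) :
    ∑ j ∈ Finset.range (n + 1),
        (ellTheta (a * b * q ^ (4 * j + 1)) (p ^ 2)
            * (ellFac (b ^ 2 * q ^ (2 * n)) (q ^ 2) (p ^ 2) j
              * ellFac (q ^ (-2 * (n : ℤ))) (q ^ 2) (p ^ 2) j
              * ellFac (a * q / b) (q ^ 2) (p ^ 2) j
              * ellFac (a * b * q) (q ^ 2) (p ^ 2) j)
            * (ellFac (-a * q) q p (2 * j) * ellFac (b * q) q p (2 * j)))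
          / (ellTheta (a * b * q) (p ^ 2)
            * (ellFac (a * q ^ (3 - 2 * (n : ℤ)) / b) (q ^ 2) (p ^ 2) j
              * ellFac (a * b * q ^ (3 + 2 * n)) (q ^ 2) (p ^ 2) j
              * ellFac (b ^ 2 * q ^ 2) (q ^ 2) (p ^ 2) j
              * ellFac (q ^ 2) (q ^ 2) (p ^ 2) j)
            * (ellFac (-b * q) q p (2 * j) * ellFac (a * q) q p (2 * j)))
          * q ^ (2 * j)
      = (ellTheta (-b) p
            * (ellFac (-q) q p n * ellFac (b / a) q p n)
            * ellFac (a * b * q ^ 3) (q ^ 2) (p ^ 2) n)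
          / (ellTheta (-b * q ^ (2 * n)) p
            * (ellFac (-b) q p n * ellFac (a * q) q p n)
            * ellFac (b / (a * q)) (q ^ 2) (p ^ 2) n)
          * q ^ (-(n : ℤ))
        * ∑ k ∈ Finset.range (n + 1),
            (ellTheta (-a * q ^ (2 * k)) p
                * (ellFac (-a) q p k * ellFac (b * q ^ n) q p k
                  * ellFac (q ^ (-(n : ℤ))) q p k * ellFac (a / b) q p k))
              / (ellTheta (-a) p
                * (ellFac q q p k * ellFac (a * q ^ (1 - (n : ℤ)) / b) q p k
                  * ellFac (a * q ^ (1 + n)) q p k * ellFac (-b * q) q p k))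
              * q ^ k := by
  -- The factors of `(q²; q², p²)_n` are the products `θ(q^{i+1}) θ(-q^{i+1})`, which supplies the
  -- non-vanishing conditions that do not depend on `a` and `b`.
  have hqq : ∀ i < n, ellTheta (q ^ (i + 1)) p ≠ 0 ∧ ellTheta (-q ^ (i + 1)) p ≠ 0 := by
    intro i hi
    have h := Finset.prod_ne_zero_iff.1 hL5 i (Finset.mem_range.2 hi)
    rw [← pow_succ', ← pow_mul, mul_comm 2, pow_mul, ellTheta_sq _ hp] at h
    exact mul_ne_zero_iff.1 h
  have hcurve : ContinuousAt (fun x : ℂ => (a * x ^ 2, b * x)) 1 := by fun_prop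
  have h1 : (a * (1 : ℂ) ^ 2, b * (1 : ℂ)) = (a, b) := by simp
  have hl := continuousAt_leftSide hp hq ha hb hL1 hL2 hL3 hL4 hL5 hL6 hL7
  have hr := continuousAt_rightSide hp hq ha hb hP1 hP2 hP3 hP4 hR1 hR2 hR3 hR4 hR5
  rw [← h1] at hl hr
  have hl' := ContinuousAt.comp (f := fun x : ℂ => (a * x ^ 2, b * x)) hl hcurve
  have hr' := ContinuousAt.comp (f := fun x : ℂ => (a * x ^ 2, b * x)) hr hcurve
  have h := tendsto_nhds_unique_of_frequently_eq hl'.tendsto hr'.tendsto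
    ((frequently_thetaGeneric hp hq ha hb).mono fun x hx =>
      leftSide_eq_rightSide_of_generic hp hq (mul_ne_zero ha (pow_ne_zero 2 hx.1))
        (mul_ne_zero hb hx.1) hx.2 (fun i hi => (hqq i hi).1) fun i hi => (hqq i hi).2)
  simp only [Function.comp_apply, one_pow, mul_one] at h
  exact h
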